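/- Let $\mathcal L_{\mathrm{or}}=\{+,-,\cdot,0,1,<\}$ be the language of ordered rings and $\mathcal L_{\mathrm{og}}=\{+,0,<\}$ the language of ordered groups. Let $T_{\mathrm{oag}}$ and $T_{\mathrm{doag}}$ be the $\mathcal L_{\mathrm{og}}$-theories of ordered abelian groups and of divisible ordered abelian groups (the trivial group being allowed). A subset $A$ of an ordered structure $N$ is dense in $N$ if for all $a<b$ in $N$ there is $c\in A$ with $a<c<b$. A set of sentences is recursive if, for a fixed Gödel numbering, the set of Gödel numbers of its elements is decidable. (1) There is a recursive $\mathcal L_{\mathrm{or}}$-theory $\Sigma'$ whose models are exactly the ordered fields $(K,+,-,\cdot,0,1,<)$ that are dense in their real closure. (2) Let $\mathcal L$ be a language expanding $\mathcal L_{\mathrm{og}}$, let $T$ be a complete $\mathcal L$-theory which extends $T_{\mathrm{doag}}$ and admits quantifier elimination, and let $\Sigma$ be an $\mathcal L$-theory which extends $T_{\mathrm{oag}}$ and all of whose axioms are consequences of $T$. Then there is an $\mathcal L$-theory $\Sigma'\supseteq\Sigma$ such that for every $\mathcal M'\models T$ and every substructure $\mathcal M\subseteq\mathcal M'$ with $\mathrm{dcl}(M;\mathcal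 M')=M'$: $$\mathcal M\models\Sigma'\iff \mathcal M\models\Sigma \text{ and } M \text{ is dense in } M'.$$ Moreover, for every Gödel numbering of the symbols of $\mathcal L$ for which "$c$ is the code of an $n$-ary function symbol" and "$c$ is the code of an $n$-ary relation symbol" are decidable relations of $(c,n)$: if $\Sigma$ and $T$ are recursive, then $\Sigma'$ can also be chosen recursive. -/

import Mathlib

open FirstOrder FirstOrder.Language

universe u v w

namespace DenseRC

/-! ### Languages -/

/-- Function symbols of the language of ordered groups `{+, 0, <}`. -/
inductive OgFunc : ℕ → Type
  | zero : OgFunc 0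
  | add : OgFunc 2

/-- Function symbols of the language of ordered rings `{+, -, ·, 0, 1, <}`. -/
inductive OrFunc : ℕ → Type
  | zero : OrFunc 0
  | one : OrFunc 0
  | neg : OrFunc 1
  | add : OrFunc 2
  | mul : OrFunc 2

/-- The single binary relation symbol `<`. -/
inductive LtRel : ℕ → Type
  | lt : LtRel 2

/-- The language of ordered groups `{+, 0, <}`. -/
def Log : FirstOrder.Language := ⟨OgFunc, LtRel⟩

/-- The language of ordered rings `{+, -, ·, 0, 1, <}`. -/
def Lor : FirstOrder.Language := ⟨OrFunc, LtRel⟩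

/-! ### The theory of (divisible) ordered abelian groups -/

section Groups

variable {n : ℕ}

/-- The term `0`. -/
def zeroTerm : Log.Term (Empty ⊕ Fin n) := Constants.term (L := Log) OgFunc.zero

/-- The term `s + t`. -/
def addTerm (s t : Log.Term (Empty ⊕ Fin n)) : Log.Term (Empty ⊕ Fin n) :=
  Functions.apply₂ (L := Log) OgFunc.add s t

/-- The term `k · t = t + ⋯ + t`. -/
def nsmulTerm : ℕ → Log.Term (Empty ⊕ Fin n) → Log.Term (Empty ⊕ Fin n)
  | 0, _ => zeroTerm
  | k + 1, t => addTerm (nsmulTerm k t) t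

/-- The formula `s < t`. -/
def ltFormula (s t : Log.Term (Empty ⊕ Fin n)) : Log.BoundedFormula Empty n :=
  Relations.boundedFormula₂ (L := Log) LtRel.lt s t

end Groups

/-- The theory of ordered abelian groups. -/
def Toag : Log.Theory :=
  { -- `(x + y) + z = x + (y + z)`
    ∀' ∀' ∀' (addTerm (addTerm (&0) (&1)) (&2) =' addTerm (&0) (addTerm (&1) (&2))),
    -- `x + y = y + x`
    ∀' ∀' (addTerm (&0) (&1) =' addTerm (&1) (&0)),
    -- `x + 0 = x`
    ∀' (addTerm (&0) zeroTerm =' &0),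
    -- `x` has a negative
    ∀' ∃' (addTerm (&0) (&1) =' zeroTerm),
    -- `<` is irreflexive
    ∀' ∼(ltFormula (&0) (&0)),
    -- `<` is transitive
    ∀' ∀' ∀' (ltFormula (&0) (&1) ⟹ (ltFormula (&1) (&2) ⟹ ltFormula (&0) (&2))),
    -- `<` is total
    ∀' ∀' (ltFormula (&0) (&1) ⊔ ((&0 =' &1) ⊔ ltFormula (&1) (&0))),
    -- `<` is translation invariant
    ∀' ∀' ∀' (ltFormula (&0) (&1) ⟹ ltFormula (addTerm (&0) (&2)) (addTerm (&1) (&2))) }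

/-- `∀ x ∃ y, k · y = x`. -/
def divSentence (k : ℕ) : Log.Sentence := ∀' ∃' (nsmulTerm k (&1) =' &0)

/-- The theory of divisible ordered abelian groups. Non-triviality is deliberately not required, so
that "extends `Tdoag`" is the weaker hypothesis under either convention. -/
def Tdoag : Log.Theory := Toag ∪ {σ | ∃ k : ℕ, 0 < k ∧ σ = divSentence k}

/-! ### General model theory -/

/-- The theory `T` extends the theory `S`: every axiom of `S` is a consequence of `T`. -/
def Extends {L : FirstOrder.Language.{u, v}} (T S : L.Theory) : Prop := ∀ σ ∈ S, T ⊨ᵇ σ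

/-- `T` admits quantifier elimination. -/
def HasQE {L : FirstOrder.Language.{u, v}} (T : L.Theory) : Prop :=
  ∀ (n : ℕ) (φ : L.Formula (Fin n)), ∃ ψ : L.Formula (Fin n), ψ.IsQF ∧ (φ ⇔[T] ψ)

/-- The definable closure of the set `A` in the structure `N`. -/
def dcl (L : FirstOrder.Language.{u, v}) {N : Type w} [L.Structure N] (A : Set N) : Set N :=
  {b | A.Definable₁ L {b}}

/-- `A` is dense in `N` with respect to the interpretation of `<` in `N`: strictly between any two
elements of `N` there is an element of `A`. -/
def IsDenseIn {L : FirstOrder.Language.{u, v}} (ι : Log →ᴸ L) {N : Type w} [L.Structure N] (A : Set N) :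
    Prop :=
  ∀ a b : N, Structure.RelMap (ι.onRelation (n := 2) LtRel.lt) ![a, b] →
    ∃ c ∈ A, Structure.RelMap (ι.onRelation (n := 2) LtRel.lt) ![a, c] ∧
      Structure.RelMap (ι.onRelation (n := 2) LtRel.lt) ![c, b]

/-- For all models `N` of `T` and all substructures `M` of `N` with `dcl(M; N) = N`, the structure
`M` is a model of `S'` if and only if it is a model of `S` and dense in `N`. -/
def AxiomatisesDensity {L : FirstOrder.Language.{u, v}} (ι : Log →ᴸ L) (T S S' : L.Theory) : Prop :=
  ∀ (N : Type w) [L.Structure N], N ⊨ T → ∀ M : L.Substructure N,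
    dcl L (M : Set N) = Set.univ → (M ⊨ S' ↔ (M ⊨ S ∧ IsDenseIn ι (M : Set N)))

/-! ### Recursive theories -/

/-- A Gödel numbering of the symbols of `L` for which the relations "`c` is the code of an `n`-ary
function symbol" and "`c` is the code of an `n`-ary relation symbol" are decidable. -/
structure Numbering (L : FirstOrder.Language.{u, v}) where
  fn : (Σ n, L.Functions n) → ℕ
  fn_injective : Function.Injective fn
  fn_computable : ComputablePred fun p : ℕ × ℕ => ∃ f : L.Functions p.2, fn ⟨p.2, f⟩ = p.1
  rel : (Σ n, L.Relations n) → ℕ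
  rel_injective : Function.Injective rel
  rel_computable : ComputablePred fun p : ℕ × ℕ => ∃ R : L.Relations p.2, rel ⟨p.2, R⟩ = p.1

section Goedel

variable {L : FirstOrder.Language.{u, v}} (ν : Numbering L)

/-- The Gödel number of a term in the (bound) variables indexed by `Fin n`. -/
def termCode {n : ℕ} : L.Term (Empty ⊕ Fin n) → ℕ
  | .var (.inl e) => e.elim
  | .var (.inr i) => Nat.pair 0 i
  | .func f ts => Nat.pair 1 (Nat.pair (ν.fn ⟨_, f⟩)
      (Encodable.encode (List.ofFn fun i => termCode (ts i))))

/-- The Gödel number of a formula all of whose free variables are indexed by `Fin n`. -/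
def formulaCode : {n : ℕ} → L.BoundedFormula Empty n → ℕ
  | _, .falsum => Nat.pair 0 0
  | _, .equal s t => Nat.pair 1 (Nat.pair (termCode ν s) (termCode ν t))
  | _, .rel R ts => Nat.pair 2 (Nat.pair (ν.rel ⟨_, R⟩)
      (Encodable.encode (List.ofFn fun i => termCode ν (ts i))))
  | _, .imp φ ψ => Nat.pair 3 (Nat.pair (formulaCode φ) (formulaCode ψ))
  | _, .all φ => Nat.pair 4 (formulaCode φ)

/-- A theory (set of sentences) is recursive if the set of Gödel numbers of its elements is
decidable. -/
def IsRecursive (T : L.Theory) : Prop :=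
  ComputablePred fun c : ℕ => ∃ σ : L.Sentence, σ ∈ T ∧ formulaCode ν σ = c

end Goedel

/-- Codes of the function symbols of the language of ordered rings. -/
def orFn : (Σ n, Lor.Functions n) → ℕ
  | ⟨_, OrFunc.zero⟩ => 0
  | ⟨_, OrFunc.one⟩ => 1
  | ⟨_, OrFunc.neg⟩ => 2
  | ⟨_, OrFunc.add⟩ => 3
  | ⟨_, OrFunc.mul⟩ => 4

theorem orFn_injective : Function.Injective orFn := by
  rintro ⟨_, f⟩ ⟨_, g⟩ h
  cases f <;> cases g <;> first | rfl | (exact absurd h (by simp [orFn]))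

theorem primrecPred_eq_const (a b : ℕ) :
    PrimrecPred fun p : ℕ × ℕ => p.1 = a ∧ p.2 = b :=
  (Primrec.eq.comp Primrec.fst (Primrec.const a)).and
    (Primrec.eq.comp Primrec.snd (Primrec.const b))

theorem computablePred_of_primrecPred {p : ℕ × ℕ → Prop} (h : PrimrecPred p) :
    ComputablePred p := by
  obtain ⟨d, hd⟩ := h
  exact ⟨d, hd.to_comp⟩

/-- The numbering of the symbols of the language of ordered rings: `0, 1, -, +, ·` have the codes
`0, 1, 2, 3, 4`, and `<` has the code `0`. -/
def orNumbering : Numbering Lor where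
  fn := orFn
  fn_injective := orFn_injective
  fn_computable := by
    refine computablePred_of_primrecPred (((primrecPred_eq_const 0 0).or
      ((primrecPred_eq_const 1 0).or ((primrecPred_eq_const 2 1).or
      ((primrecPred_eq_const 3 2).or (primrecPred_eq_const 4 2))))).of_eq ?_)
    rintro ⟨c, n⟩
    constructor
    · rintro (⟨h, h'⟩ | ⟨h, h'⟩ | ⟨h, h'⟩ | ⟨h, h'⟩ | ⟨h, h'⟩) <;> dsimp only at h h' <;>
        subst h h'
      exacts [⟨OrFunc.zero, rfl⟩, ⟨OrFunc.one, rfl⟩, ⟨OrFunc.neg, rfl⟩, ⟨OrFunc.add, rfl⟩,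
        ⟨OrFunc.mul, rfl⟩]
    · rintro ⟨f, h⟩
      dsimp only at f h
      subst h
      cases f <;> simp [orFn]
  rel := fun _ => 0
  rel_injective := by
    rintro ⟨_, R⟩ ⟨_, S⟩ _
    cases R; cases S; rfl
  rel_computable := by
    refine computablePred_of_primrecPred ((primrecPred_eq_const 0 2).of_eq ?_)
    rintro ⟨c, n⟩
    constructor
    · rintro ⟨h, h'⟩
      dsimp only at h h'
      subst h h'
      exact ⟨LtRel.lt, rfl⟩
    · rintro ⟨R, h⟩
      dsimp only at R h
      subst h
      cases R
      simp

/-! ### Ordered fields and their real closures -/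

/-- `R` is a real closure of the ordered field `K`: a real closed ordered field which is an algebraic
extension of `K` and whose order extends that of `K`. -/
structure IsRealClosure (K R : Type w) [Field K] [LinearOrder K] [Field R] [LinearOrder R]
    [Algebra K R] : Prop where
  isStrictOrderedRing : IsStrictOrderedRing R
  isRealClosed : IsRealClosed R
  isAlgebraic : Algebra.IsAlgebraic K R
  strictMono : StrictMono (algebraMap K R)

/-- The ordered field `K` is dense in its real closure (which is unique up to order-preserving
isomorphism over `K`): strictly between any two elements of the real closure there is an element
of `K`. -/
def DenseInRealClosure (K : Type w) [Field K] [LinearOrder K] : Prop :=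
  ∃ (R : Type w) (_ : Field R) (_ : LinearOrder R) (_ : Algebra K R), IsRealClosure K R ∧
    ∀ a b : R, a < b → ∃ c : K, a < algebraMap K R c ∧ algebraMap K R c < b

/-- The symbols of the language of ordered rings are interpreted in `K` by the given field
operations and the given order. -/
structure IsOrderedFieldStructure (K : Type w) [Lor.Structure K] [Field K] [LinearOrder K] :
    Prop where
  isStrictOrderedRing : IsStrictOrderedRing K
  zero : ∀ x : Fin 0 → K, Structure.funMap (L := Lor) OrFunc.zero x = 0
  one : ∀ x : Fin 0 → K, Structure.funMap (L := Lor) OrFunc.one x = 1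
  neg : ∀ x : Fin 1 → K, Structure.funMap (L := Lor) OrFunc.neg x = -x 0
  add : ∀ x : Fin 2 → K, Structure.funMap (L := Lor) OrFunc.add x = x 0 + x 1
  mul : ∀ x : Fin 2 → K, Structure.funMap (L := Lor) OrFunc.mul x = x 0 * x 1
  lt : ∀ x : Fin 2 → K, Structure.RelMap (L := Lor) LtRel.lt x ↔ x 0 < x 1

/-- The structure `K` in the language of ordered rings is an ordered field which is dense in its
real closure. -/
def IsOrderedFieldDenseInRealClosure (K : Type w) [Lor.Structure K] : Prop :=
  ∃ (_ : Field K) (_ : LinearOrder K), IsOrderedFieldStructure K ∧ DenseInRealClosure K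

end DenseRC

/-! Part (2). Quantifier-free formulas have the same truth value in `M` and in `N`, so density of
`M` in `N` is expressed through them. The new axioms are the sentences ∀x (θ(x) → ∃z θ'(x,z)), with
θ and θ' quantifier-free, for which `T` proves: whenever θ(x) holds, some interval (a,b) with a < b
lies inside θ'(x,·). If `M` is dense in `N`, such an interval in `N` contains a point of `M`, and
the axiom holds in `M`. Conversely, let a < b in `N`. As dcl(M) = N, the interval (a,b) is definable
with parameters x from `M`, and quantifier elimination gives a quantifier-free definition θ'(x,z).
Let θ be a quantifier-free equivalent of "θ'(x,·) contains an interval". The axiom for θ and θ' then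
yields a point of `M` in (a,b). This is `axiomatisesDensity`.

Recursiveness. These axioms are only recursively enumerable, because their side condition is that
`T` entails a sentence. That the consequences of `T` are enumerable is a form of the completeness
theorem, `models_iff_refuted`: a sentence follows from `T` iff its negation is refuted by finitely
many case distinctions from an enumerable set of contradictory clauses. An irrefutable set of
literals extends to a valuation, from which a term model is read off; its elements are named by
numbers, and Henkin witnesses are among the names. Conversely, every nonempty structure induces a
valuation. Craig's trick (`exists_isRecursive`) replaces an enumerable axiom set by a decidable one
with the same models.

Part (1). An ordered field `K` is dense in its real closure iff positive elements have approximate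
square roots and monic polynomials of odd degree have approximate roots in `K`; this is a recursive
scheme. If `K` is dense in a real closed `R`, take an exact root in `R` and move it into `K` by
continuity. For the converse, let `F` be the completion of `K`, an ordered field in which `K` is
dense. Approximate roots pass from `K` to `F` by perturbing coefficients, and completeness makes
them exact: by Lagrange interpolation a monic polynomial cannot be small at too many separated
points, so an ultrafilter along which it tends to 0 is Cauchy (`exists_root_of_approx`). The
relative algebraic closure of `K` in `F` is therefore real closed; it is algebraic over `K`, and `K`
is dense in it. -/

namespace DenseRC

/-! ### Semidecidable predicates -/

section SemiDec

variable {α β : Type*} [Primcodable α] [Primcodable β]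

/-- A predicate is semidecidable if it is the projection of a decidable relation. -/
def SemiDec (p : α → Prop) : Prop :=
  ∃ f : α × ℕ → Bool, Computable f ∧ ∀ a, p a ↔ ∃ k, f (a, k) = true

theorem SemiDec.of_iff {p q : α → Prop} (hp : SemiDec p) (h : ∀ a, q a ↔ p a) : SemiDec q := by
  obtain ⟨f, hf, h'⟩ := hp
  exact ⟨f, hf, fun a => (h a).trans (h' a)⟩

theorem semiDec_of_computablePred {p : α → Prop} (hp : ComputablePred p) : SemiDec p := by
  obtain ⟨d, hd⟩ := hp
  exact ⟨fun x => decide (p x.1), hd.comp Computable.fst, fun a => by simp⟩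

theorem semiDec_of_primrecPred {p : α → Prop} (hp : PrimrecPred p) : SemiDec p :=
  semiDec_of_computablePred hp.computablePred

theorem SemiDec.comp {p : β → Prop} (hp : SemiDec p) {g : α → β} (hg : Computable g) :
    SemiDec fun a => p (g a) := by
  obtain ⟨f, hf, h⟩ := hp
  exact ⟨fun x => f (g x.1, x.2), hf.comp ((hg.comp Computable.fst).pair Computable.snd),
    fun a => h (g a)⟩

theorem SemiDec.and {p q : α → Prop} (hp : SemiDec p) (hq : SemiDec q) :
    SemiDec fun a => p a ∧ q a := by
  obtain ⟨f, hf, h⟩ := hp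
  obtain ⟨g, hg, h'⟩ := hq
  have h2 := Computable.unpair.comp (Computable.snd (α := α) (β := ℕ))
  refine ⟨fun x => f (x.1, x.2.unpair.1) && g (x.1, x.2.unpair.2), Primrec.and.to_comp.comp
    (hf.comp (Computable.fst.pair (Computable.fst.comp h2)))
    (hg.comp (Computable.fst.pair (Computable.snd.comp h2))), fun a => ?_⟩
  simp only [h, h']
  constructor
  · rintro ⟨⟨i, hi⟩, ⟨j, hj⟩⟩
    exact ⟨Nat.pair i j, by simp [hi, hj]⟩
  · rintro ⟨k, hk⟩
    rw [Bool.and_eq_true] at hk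
    exact ⟨⟨_, hk.1⟩, ⟨_, hk.2⟩⟩

theorem SemiDec.or {p q : α → Prop} (hp : SemiDec p) (hq : SemiDec q) :
    SemiDec fun a => p a ∨ q a := by
  obtain ⟨f, hf, h⟩ := hp
  obtain ⟨g, hg, h'⟩ := hq
  refine ⟨fun x => f x || g x, Primrec.or.to_comp.comp hf hg, fun a => ?_⟩
  simp only [h, h', Bool.or_eq_true, exists_or]

theorem SemiDec.exists {p : α × β → Prop} (hp : SemiDec p) : SemiDec fun a => ∃ b, p (a, b) := by
  obtain ⟨f, hf, h⟩ := hp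
  have h2 := Computable.unpair.comp (Computable.snd (α := α) (β := ℕ))
  refine ⟨fun x => ((Encodable.decode (α := β) x.2.unpair.1).map
    fun b => f ((x.1, b), x.2.unpair.2)).getD false, ?_, fun a => ?_⟩
  · refine Computable.option_getD (Computable.option_map
      (Computable.decode.comp (Computable.fst.comp h2)) ?_) (Computable.const false)
    exact (hf.comp (((Computable.fst.comp Computable.fst).pair Computable.snd).pair
      ((Computable.snd.comp h2).comp Computable.fst))).to₂
  · constructor
    · rintro ⟨b, hb⟩
      obtain ⟨k, hk⟩ := (h _).1 hb
      exact ⟨Nat.pair (Encodable.encode b) k, by simpa using hk⟩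
    · rintro ⟨k, hk⟩
      cases hd : Encodable.decode (α := β) k.unpair.1 with
      | none => simp [hd] at hk
      | some b => exact ⟨b, (h _).2 ⟨k.unpair.2, by simpa [hd] using hk⟩⟩

theorem semiDec_range {g : β → α} (hg : Computable g) : SemiDec fun a => ∃ b, g b = a := by
  classical
  refine SemiDec.exists (p := fun x : α × β => g x.2 = x.1) (semiDec_of_computablePred ?_)
  have h : PrimrecPred fun x : α × α => x.1 = x.2 := Primrec.eq
  have h' : Computable fun x : α × β => decide (g x.2 = x.1) :=
    h.decide.to_comp.comp ((hg.comp Computable.snd).pair Computable.fst)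
  exact h'.computablePred

/-- The least set containing `A` and closed under the rules "from `a` and `b` infer `c`" given
by `R`. -/
inductive Closure (A : α → Prop) (R : α × α × α → Prop) : α → Prop
  | base {a : α} : A a → Closure A R a
  | step {a b c : α} : Closure A R a → Closure A R b → R (a, b, c) → Closure A R c

/-- One step of the enumeration of the elements of an inductively generated set. -/
def closureStep (f : α × ℕ → Bool) (g : (α × α × α) × ℕ → Bool) (L : List α)
    (q : ℕ × ℕ × ℕ × α × ℕ) : List α :=
  bif f q.2.2.2 || ((L[q.2.1]?.bind fun a => L[q.2.2.1]?.map
    fun b => g ((a, b, q.2.2.2.1), q.2.2.2.2)).getD false) then L ++ [q.2.2.2.1] else L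

/-- The list of elements of an inductively generated set enumerated up to the stage `n`. -/
def closureStage (f : α × ℕ → Bool) (g : (α × α × α) × ℕ → Bool) : ℕ → List α
  | 0 => []
  | n + 1 => ((Encodable.decode (α := ℕ × ℕ × ℕ × α × ℕ) n).map
      (closureStep f g (closureStage f g n))).getD (closureStage f g n)

theorem computable_closureStep {f : α × ℕ → Bool} {g : (α × α × α) × ℕ → Bool}
    (hf : Computable f) (hg : Computable g) : Computable₂ (closureStep f g) := by
  have q := Computable.snd (α := List α) (β := ℕ × ℕ × ℕ × α × ℕ)
  have q2 := Computable.snd.comp q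
  have q22 := Computable.snd.comp q2
  have q3 := Computable.snd.comp q22
  have L := Computable.fst (α := List α) (β := ℕ × ℕ × ℕ × α × ℕ)
  refine Computable.cond (Primrec.or.to_comp.comp (hf.comp q3) (Computable.option_getD
    (Computable.option_bind (Computable.list_getElem?.comp L (Computable.fst.comp q2)) ?_)
    (Computable.const false))) (Computable.list_append.comp L
      (Computable.list_cons.comp (Computable.fst.comp q3) (Computable.const []))) L
  have F := Computable.fst (α := List α × (ℕ × ℕ × ℕ × α × ℕ)) (β := α)
  have q3' := q3.comp (F.comp (Computable.fst (β := α)))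
  have S := Computable.snd (α := List α × (ℕ × ℕ × ℕ × α × ℕ)) (β := α)
  have hg' : Computable₂ fun (x : (List α × (ℕ × ℕ × ℕ × α × ℕ)) × α) (b : α) =>
      g ((x.2, b, x.1.2.2.2.2.1), x.1.2.2.2.2.2) :=
    (hg.comp (((S.comp Computable.fst).pair (Computable.snd.pair
      (Computable.fst.comp q3'))).pair (Computable.snd.comp q3'))).to₂
  exact (Computable.option_map (Computable.list_getElem?.comp (L.comp F)
    ((Computable.fst.comp q22).comp F)) hg').to₂

theorem computable_closureStage {f : α × ℕ → Bool} {g : (α × α × α) × ℕ → Bool}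
    (hf : Computable f) (hg : Computable g) : Computable (closureStage f g) := by
  have h := Computable.nat_rec (f := fun n : ℕ => n) (g := fun _ => ([] : List α))
    (h := fun _ x => ((Encodable.decode (α := ℕ × ℕ × ℕ × α × ℕ) x.1).map
      (closureStep f g x.2)).getD x.2) Computable.id (Computable.const []) ?_
  · refine h.of_eq fun n => ?_
    induction n with
    | zero => rfl
    | succ n ih => simp only [closureStage, ← ih]
  · have x := Computable.snd (α := ℕ) (β := ℕ × List α)
    have x2 := (Computable.snd.comp x).comp
      (Computable.fst (α := ℕ × ℕ × List α) (β := ℕ × ℕ × ℕ × α × ℕ))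
    exact (Computable.option_getD (Computable.option_map
      (Computable.decode.comp (Computable.fst.comp x))
      ((computable_closureStep hf hg).comp x2 Computable.snd).to₂) (Computable.snd.comp x)).to₂

theorem closureStage_succ (f : α × ℕ → Bool) (g : (α × α × α) × ℕ → Bool) (n : ℕ) :
    closureStage f g (n + 1) = closureStage f g n ∨
      ∃ q, closureStage f g (n + 1) = closureStep f g (closureStage f g n) q := by
  rw [closureStage]
  cases Encodable.decode (α := ℕ × ℕ × ℕ × α × ℕ) n with
  | none => exact .inl rfl
  | some q => exact .inr ⟨q, rfl⟩

theorem closureStage_prefix (f : α × ℕ → Bool) (g : (α × α × α) × ℕ → Bool) {m n : ℕ}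
    (h : m ≤ n) : closureStage f g m <+: closureStage f g n := by
  induction h with
  | refl => exact List.prefix_rfl
  | @step n _ ih =>
    refine ih.trans ?_
    rcases closureStage_succ f g n with h | ⟨q, h⟩ <;> rw [h]
    simp only [closureStep, Bool.cond_eq_ite]
    split_ifs
    · exact List.prefix_append _ _
    · exact List.prefix_rfl

/-- All derivations are enumerated by one growing list. The stage number is read as a guess: two
positions of premises already in the list, a conclusion, and a certificate for the axiom or rule
used. -/
theorem SemiDec.closure {A : α → Prop} {R : α × α × α → Prop} (hA : SemiDec A) (hR : SemiDec R) :
    SemiDec (Closure A R) := by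
  classical
  obtain ⟨f, hf, h⟩ := hA
  obtain ⟨g, hg, h'⟩ := hR
  have hmem : PrimrecPred fun x : α × List α => ∃ b ∈ x.2, b = x.1 :=
    (PrimrecRel.exists_mem_list Primrec.eq).comp Primrec.snd Primrec.fst
  have hs := computable_closureStage hf hg
  refine ⟨fun x => decide (∃ b ∈ closureStage f g x.2, b = x.1), hmem.decide.to_comp.comp
    (Computable.fst.pair (hs.comp Computable.snd)), fun a => ?_⟩
  simp only [decide_eq_true_eq, exists_eq_right]
  constructor
  · intro ha
    induction ha with
    | @base a ha =>
      obtain ⟨k, hk⟩ := (h a).1 ha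
      refine ⟨Encodable.encode (0, 0, 0, a, k) + 1, ?_⟩
      rw [closureStage, Encodable.encodek]
      simp [closureStep, hk]
    | @step a b c _ _ hr iha ihb =>
      obtain ⟨k, hk⟩ := (h' _).1 hr
      obtain ⟨m, hm⟩ := iha
      obtain ⟨n, hn⟩ := ihb
      obtain ⟨i, hi⟩ := List.mem_iff_getElem?.1 hm
      obtain ⟨j, hj⟩ := List.mem_iff_getElem?.1 hn
      -- The first entry plays no part in the step itself. It only makes the code at least `m + n`,
      -- so that both premises are already listed at that stage.
      refine ⟨Encodable.encode (m + n, i, j, c, k) + 1, ?_⟩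
      have hle : m + n ≤ Encodable.encode (m + n, i, j, c, k) := by
        rw [Encodable.encode_prod_val]
        exact Nat.left_le_pair _ _
      have get : ∀ {r l : ℕ} {d : α}, r ≤ m + n → (closureStage f g r)[l]? = some d →
          (closureStage f g (Encodable.encode (m + n, i, j, c, k)))[l]? = some d := by
        intro r l d hr hd
        obtain ⟨t, ht⟩ := closureStage_prefix f g (hr.trans hle)
        rw [← ht, List.getElem?_append_left (List.getElem?_eq_some_iff.1 hd).1, hd]
      rw [closureStage, Encodable.encodek]
      have hi' := get (Nat.le_add_right m n) hi
      have hj' := get (Nat.le_add_left n m) hj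
      generalize closureStage f g (Encodable.encode (m + n, i, j, c, k)) = L at hi' hj' ⊢
      simp [closureStep, hi', hj', hk]
  · rintro ⟨n, hn⟩
    induction n generalizing a with
    | zero => simp [closureStage] at hn
    | succ n ih =>
      rcases closureStage_succ f g n with hs | ⟨⟨_, i, j, c, k⟩, hs⟩ <;> rw [hs] at hn
      · exact ih a hn
      · simp only [closureStep, Bool.cond_eq_ite] at hn
        split_ifs at hn with hif
        · rcases List.mem_append.1 hn with hn | hn
          · exact ih a hn
          · rw [List.mem_singleton] at hn
            subst hn
            rcases Bool.or_eq_true_iff.1 hif with hif | hif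
            · exact .base ((h _).2 ⟨_, hif⟩)
            · cases hi : (closureStage f g n)[i]? with
              | none => simp [hi] at hif
              | some b =>
                cases hj : (closureStage f g n)[j]? with
                | none => simp [hj] at hif
                | some c =>
                  exact .step (ih _ (List.mem_of_getElem? hi)) (ih _ (List.mem_of_getElem? hj))
                    ((h' _).2 ⟨k, by simpa [hi, hj] using hif⟩)
        · exact ih a hn

end SemiDec

/-! ### Refutations of sets of clauses -/

section Refutation

variable {α : Type*}

/-- The literal `(a, b)` holds under the valuation `v` if `a` has the truth value `b`. -/
def Holds (v : α → Prop) (x : α × Bool) : Prop := v x.1 ↔ x.2 = true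

/-- The finite sets of literals which are refuted by finitely many case distinctions, where the
lists of literals in `C` are contradictory. -/
def Refuted (C : List (α × Bool) → Prop) : List (α × Bool) → Prop :=
  Closure (fun Γ => ∃ Δ, C Δ ∧ ∀ x ∈ Δ, x ∈ Γ)
    (fun x => ∃ a, (a, true) :: x.2.2 = x.1 ∧ (a, false) :: x.2.2 = x.2.1)

/-- Soundness of refutations: a valuation that makes both branches of a case distinction fail must
already falsify a literal of the common part. -/
theorem Refuted.exists_not_holds {C : List (α × Bool) → Prop} {v : α → Prop}
    (hv : ∀ Δ, C Δ → ∃ x ∈ Δ, ¬ Holds v x) {Γ : List (α × Bool)} (h : Refuted C Γ) :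
    ∃ x ∈ Γ, ¬ Holds v x := by
  induction h with
  | base h =>
    obtain ⟨Δ, hΔ, hs⟩ := h
    obtain ⟨x, hx, hx'⟩ := hv Δ hΔ
    exact ⟨x, hs x hx, hx'⟩
  | step _ _ h ih ih' =>
    obtain ⟨a, h1, h2⟩ := h
    dsimp only at h1 h2
    subst h1 h2
    simp only [List.mem_cons, exists_eq_or_imp] at ih ih'
    rcases ih with h | h
    · rcases ih' with h' | h'
      · simp only [Holds] at h h'
        tauto
      · exact h'
    · exact h

theorem Refuted.cut {C : List (α × Bool) → Prop} {Γ : List (α × Bool)} (a : α)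
    (h : Refuted C ((a, true) :: Γ)) (h' : Refuted C ((a, false) :: Γ)) : Refuted C Γ :=
  .step h h' ⟨a, rfl, rfl⟩

/-- Extend a set of literals by deciding the atoms with codes less than `n` without creating a
refutable set. -/
noncomputable def extendLiterals [Encodable α] (C : List (α × Bool) → Prop) (Γ : List (α × Bool)) :
    ℕ → List (α × Bool)
  | 0 => Γ
  | n + 1 => open Classical in
    match Encodable.decode (α := α) n with
    | none => extendLiterals C Γ n
    | some a => if Refuted C ((a, true) :: extendLiterals C Γ n)
        then (a, false) :: extendLiterals C Γ n else (a, true) :: extendLiterals C Γ n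

/-- A Lindenbaum argument: deciding the atoms one after another keeps the finite set irrefutable, by
the cut rule. A clause is finite, so if all its literals held, it would already lie inside some
stage. -/
theorem exists_holds_of_not_refuted [Encodable α] {C : List (α × Bool) → Prop}
    (hC : ∀ a, C [(a, true), (a, false)]) {Γ : List (α × Bool)} (h : ¬ Refuted C Γ) :
    ∃ v : α → Prop, (∀ x ∈ Γ, Holds v x) ∧ ∀ Δ, C Δ → ∃ x ∈ Δ, ¬ Holds v x := by
  classical
  have hsucc : ∀ n, extendLiterals C Γ n ⊆ extendLiterals C Γ (n + 1) := by
    intro n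
    rw [extendLiterals]
    cases Encodable.decode (α := α) n with
    | none => exact List.Subset.refl _
    | some a =>
      dsimp only
      split_ifs <;> exact List.subset_cons_self _ _
  have hmono : ∀ {m n}, m ≤ n → extendLiterals C Γ m ⊆ extendLiterals C Γ n := by
    intro m n hmn
    induction hmn with
    | refl => exact List.Subset.refl _
    | step _ ih => exact List.Subset.trans ih (hsucc _)
  have hcons : ∀ n, ¬ Refuted C (extendLiterals C Γ n) := by
    intro n
    induction n with
    | zero => exact h
    | succ n ih =>
      rw [extendLiterals]
      cases Encodable.decode (α := α) n with
      | none => exact ih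
      | some a =>
        dsimp only
        split_ifs with hif
        · exact fun h' => ih (Refuted.cut a hif h')
        · exact hif
  have hbase : ∀ n Δ, C Δ → ¬ Δ ⊆ extendLiterals C Γ n :=
    fun n Δ hΔ hs => hcons n (.base ⟨Δ, hΔ, hs⟩)
  have hdec : ∀ a, (a, true) ∈ extendLiterals C Γ (Encodable.encode a + 1) ∨
      (a, false) ∈ extendLiterals C Γ (Encodable.encode a + 1) := by
    intro a
    rw [extendLiterals, Encodable.encodek]
    dsimp only
    split_ifs <;> simp
  -- The stage `encode a + 1` is the first one after the atom `a` has been decided.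
  let v : α → Prop := fun a => (a, true) ∈ extendLiterals C Γ (Encodable.encode a + 1)
  have hmem : ∀ (x : α × Bool), Holds v x → x ∈ extendLiterals C Γ (Encodable.encode x.1 + 1) := by
    rintro ⟨a, b⟩ hx
    cases b with
    | true => exact hx.2 rfl
    | false => exact (hdec a).resolve_left fun h' => absurd (hx.1 h') (by simp)
  have hholds : ∀ (x : α × Bool) (n : ℕ), x ∈ extendLiterals C Γ n → Holds v x := by
    rintro ⟨a, b⟩ n hx
    have h1 := hmono (Nat.le_max_left n (Encodable.encode a + 1)) hx
    have h2 := @hmono _ _ (Nat.le_max_right n (Encodable.encode a + 1))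
    by_contra hn
    cases b with
    | true =>
      refine absurd ⟨fun _ => rfl, fun _ => ?_⟩ hn
      refine (hdec a).resolve_right fun h' => ?_
      -- Stages are nested, so opposite literals of one atom would meet in a common stage, which
      -- `hC` forbids.
      exact hbase _ _ (hC a) (by
        simp only [List.cons_subset, List.nil_subset, and_true]
        exact ⟨h1, h2 h'⟩)
    | false =>
      have hv : v a := by
        by_contra hv
        exact hn ⟨fun h' => absurd h' hv, fun h' => by simp at h'⟩
      exact hbase _ _ (hC a) (by
        simp only [List.cons_subset, List.nil_subset, and_true]
        exact ⟨h2 hv, h1⟩)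
  refine ⟨v, fun x hx => hholds x 0 hx, fun Δ hΔ => ?_⟩
  by_contra! hall
  have : ∃ n, Δ ⊆ extendLiterals C Γ n := by
    clear hΔ
    induction Δ with
    | nil => exact ⟨0, List.nil_subset _⟩
    | cons x Δ ih =>
      obtain ⟨n, hn⟩ := ih fun y hy => hall y (List.mem_cons_of_mem _ hy)
      refine ⟨max n (Encodable.encode x.1 + 1), List.cons_subset.2
        ⟨hmono (Nat.le_max_right _ _) (hmem x (hall x List.mem_cons_self)), ?_⟩⟩
      exact List.Subset.trans hn (hmono (Nat.le_max_left _ _))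
  obtain ⟨n, hn⟩ := this
  exact hbase n Δ hΔ hn

theorem SemiDec.refuted [Primcodable α] {C : List (α × Bool) → Prop} (hC : SemiDec C) :
    SemiDec (Refuted C) := by
  classical
  refine SemiDec.closure ?_ ?_
  · refine SemiDec.exists (p := fun x : List (α × Bool) × List (α × Bool) =>
      C x.2 ∧ ∀ y ∈ x.2, y ∈ x.1) ((hC.comp Computable.snd).and (semiDec_of_primrecPred ?_))
    have h : PrimrecRel fun (Γ : List (α × Bool)) (y : α × Bool) => ∃ z ∈ Γ, z = y :=
      PrimrecRel.exists_mem_list Primrec.eq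
    have h' : PrimrecRel fun (y : α × Bool) (Γ : List (α × Bool)) => ∃ z ∈ Γ, z = y := h.swap
    exact (h'.forall_mem_list.comp Primrec.snd Primrec.fst).of_eq fun x => by simp
  · refine SemiDec.exists (p := fun x : (List (α × Bool) × List (α × Bool) × List (α × Bool)) × α =>
      (x.2, true) :: x.1.2.2 = x.1.1 ∧ (x.2, false) :: x.1.2.2 = x.1.2.1)
      (semiDec_of_primrecPred (PrimrecPred.and ?_ ?_))
    · exact Primrec.eq.comp (Primrec.list_cons.comp (Primrec.snd.pair (Primrec.const true))
        (Primrec.snd.comp (Primrec.snd.comp Primrec.fst))) (Primrec.fst.comp Primrec.fst)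
    · exact Primrec.eq.comp (Primrec.list_cons.comp (Primrec.snd.pair (Primrec.const false))
        (Primrec.snd.comp (Primrec.snd.comp Primrec.fst)))
        (Primrec.fst.comp (Primrec.snd.comp Primrec.fst))

end Refutation

/-! ### Coded Henkin clauses -/

/-- Atoms of the coded propositional language: truth of a formula (given by its code) under an
assignment of names, equality of two names, equality of the values of two lists of terms. -/
abbrev HenkinAtom := ℕ × (ℕ × List ℕ) × (ℕ × List ℕ)

/-- The formula with code `c` is true under the assignment `s`. -/
def truthAtom (c : ℕ) (s : List ℕ) : HenkinAtom := (0, (c, s), (0, []))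

/-- The names `a` and `b` denote the same element. -/
def nameAtom (a b : ℕ) : HenkinAtom := (1, (a, []), (b, []))

/-- The list of terms with code `l` under the assignment `s` has the same values as the list of
terms with code `l'` under the assignment `s'`. -/
def listAtom (l : ℕ) (s : List ℕ) (l' : ℕ) (s' : List ℕ) : HenkinAtom := (2, (l, s), (l', s'))

/-- The name of the value of the term with code `t` under the assignment `s`. -/
def termName (t : ℕ) (s : List ℕ) : ℕ := Nat.pair 0 (Nat.pair t (Encodable.encode s))

/-- The name of a counterexample to the formula with code `c` under the assignment `s`. -/
def witnessName (c : ℕ) (s : List ℕ) : ℕ := Nat.pair 1 (Nat.pair c (Encodable.encode s))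

/-- Parameters of the logical clauses. -/
abbrev ClauseParam := (ℕ × ℕ × ℕ) × List ℕ × List ℕ

/-- The schemes of contradictory sets of literals expressing Tarski's clauses for the truth of
formulas and the properties of equality. -/
def henkinSchemes : List (ClauseParam → List (HenkinAtom × Bool)) :=
  [ fun p => [(truthAtom 0 p.2.1, true)],
    fun p => [(truthAtom (Nat.pair 3 (Nat.pair p.1.1 p.1.2.1)) p.2.1, true),
      (truthAtom p.1.1 p.2.1, true), (truthAtom p.1.2.1 p.2.1, false)],
    fun p => [(truthAtom (Nat.pair 3 (Nat.pair p.1.1 p.1.2.1)) p.2.1, false),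
      (truthAtom p.1.1 p.2.1, false)],
    fun p => [(truthAtom (Nat.pair 3 (Nat.pair p.1.1 p.1.2.1)) p.2.1, false),
      (truthAtom p.1.2.1 p.2.1, true)],
    fun p => [(truthAtom (Nat.pair 4 p.1.1) p.2.1, true),
      (truthAtom p.1.1 (p.2.1 ++ [p.1.2.1]), false)],
    fun p => [(truthAtom (Nat.pair 4 p.1.1) p.2.1, false),
      (truthAtom p.1.1 (p.2.1 ++ [witnessName p.1.1 p.2.1]), true)],
    fun p => [(truthAtom (Nat.pair 1 (Nat.pair p.1.1 p.1.2.1)) p.2.1, true),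
      (nameAtom (termName p.1.1 p.2.1) (termName p.1.2.1 p.2.1), false)],
    fun p => [(truthAtom (Nat.pair 1 (Nat.pair p.1.1 p.1.2.1)) p.2.1, false),
      (nameAtom (termName p.1.1 p.2.1) (termName p.1.2.1 p.2.1), true)],
    fun p => [(nameAtom p.1.1 p.1.1, false)],
    fun p => [(nameAtom p.1.1 p.1.2.1, true), (nameAtom p.1.2.2 p.1.2.1, true),
      (nameAtom p.1.1 p.1.2.2, false)],
    fun p => [(nameAtom (termName (Nat.pair 0 p.1.1) p.2.1) (p.2.1.getD p.1.1 0), false)],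
    fun p => [(listAtom 0 p.2.1 0 p.2.2, false)],
    fun p => [(nameAtom (termName p.1.1.unpair.1 p.2.1) (termName p.1.2.1.unpair.1 p.2.2), true),
      (listAtom p.1.1.unpair.2 p.2.1 p.1.2.1.unpair.2 p.2.2, true),
      (listAtom (Nat.succ p.1.1) p.2.1 (Nat.succ p.1.2.1) p.2.2, false)],
    fun p => [(listAtom p.1.1 p.2.1 p.1.2.1 p.2.2, true),
      (nameAtom (termName (Nat.pair 1 (Nat.pair p.1.2.2 p.1.1)) p.2.1)
        (termName (Nat.pair 1 (Nat.pair p.1.2.2 p.1.2.1)) p.2.2), false)],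
    fun p => [(listAtom p.1.1 p.2.1 p.1.2.1 p.2.2, true),
      (truthAtom (Nat.pair 2 (Nat.pair p.1.2.2 p.1.1)) p.2.1, true),
      (truthAtom (Nat.pair 2 (Nat.pair p.1.2.2 p.1.2.1)) p.2.2, false)] ]

/-- The contradictory sets of literals of the Henkin theory of a set of (codes of) sentences. -/
def HenkinClause (A : ℕ → Prop) (Δ : List (HenkinAtom × Bool)) : Prop :=
  (∃ a, [(a, true), (a, false)] = Δ) ∨ (∃ c, A c ∧ [(truthAtom c [], false)] = Δ) ∨
    ∃ g ∈ henkinSchemes, ∃ p, g p = Δ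

/-! ### Primitive recursiveness of the Henkin clauses -/

section Primrec

variable {α : Type*} [Primcodable α]

theorem primrec_natPair {f g : α → ℕ} (hf : Primrec f) (hg : Primrec g) :
    Primrec fun a => Nat.pair (f a) (g a) := Primrec₂.natPair.comp hf hg

theorem primrec_truthAtom {f : α → ℕ} {s : α → List ℕ} (hf : Primrec f) (hs : Primrec s) :
    Primrec fun a => truthAtom (f a) (s a) :=
  (Primrec.const 0).pair ((hf.pair hs).pair (Primrec.const (0, [])))

theorem primrec_nameAtom {f g : α → ℕ} (hf : Primrec f) (hg : Primrec g) :
    Primrec fun a => nameAtom (f a) (g a) :=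
  (Primrec.const 1).pair ((hf.pair (Primrec.const [])).pair (hg.pair (Primrec.const [])))

theorem primrec_listAtom {f g : α → ℕ} {s t : α → List ℕ} (hf : Primrec f) (hs : Primrec s)
    (hg : Primrec g) (ht : Primrec t) :
    Primrec fun a => listAtom (f a) (s a) (g a) (t a) :=
  (Primrec.const 2).pair ((hf.pair hs).pair (hg.pair ht))

theorem primrec_termName {f : α → ℕ} {s : α → List ℕ} (hf : Primrec f) (hs : Primrec s) :
    Primrec fun a => termName (f a) (s a) :=
  primrec_natPair (Primrec.const 0) (primrec_natPair hf (Primrec.encode.comp hs))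

theorem primrec_witnessName {f : α → ℕ} {s : α → List ℕ} (hf : Primrec f) (hs : Primrec s) :
    Primrec fun a => witnessName (f a) (s a) :=
  primrec_natPair (Primrec.const 1) (primrec_natPair hf (Primrec.encode.comp hs))

theorem primrec_cons {β : Type*} [Primcodable β] {f : α → β} {s : α → List β} (hf : Primrec f)
    (hs : Primrec s) : Primrec fun a => f a :: s a :=
  Primrec.list_cons.comp hf hs

theorem primrec_append {β : Type*} [Primcodable β] {s t : α → List β} (hs : Primrec s)
    (ht : Primrec t) : Primrec fun a => s a ++ t a :=
  Primrec.list_append.comp hs ht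

theorem primrec_getD {f : α → ℕ} {s : α → List ℕ} (hf : Primrec f) (hs : Primrec s) :
    Primrec fun a => (s a).getD (f a) 0 := (Primrec.list_getD 0).comp hs hf

end Primrec

theorem primrec_henkinSchemes : ∀ g ∈ henkinSchemes, Primrec g := by
  simp only [henkinSchemes, List.forall_mem_cons]
  refine ⟨?_, ?_, ?_, ?_, ?_, ?_, ?_, ?_, ?_, ?_, ?_, ?_, ?_, ?_, ?_, List.forall_mem_nil _⟩ <;>
  repeat' first
    | with_reducible exact Primrec.const _
    | with_reducible exact Primrec.fst
    | with_reducible exact Primrec.snd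
    | with_reducible apply primrec_cons
    | with_reducible apply primrec_truthAtom
    | with_reducible apply primrec_nameAtom
    | with_reducible apply primrec_listAtom
    | with_reducible apply primrec_termName
    | with_reducible apply primrec_witnessName
    | with_reducible apply primrec_natPair
    | with_reducible apply primrec_getD
    | with_reducible apply primrec_append
    | with_reducible apply Primrec.succ.comp
    | with_reducible apply Primrec.fst.comp
    | with_reducible apply Primrec.snd.comp
    | with_reducible apply Primrec.unpair.comp
    | with_reducible apply Primrec.pair

theorem SemiDec.henkinClause {A : ℕ → Prop} (hA : SemiDec A) : SemiDec (HenkinClause A) := by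
  refine SemiDec.or (semiDec_range ?_) (SemiDec.or ?_ ?_)
  · exact (primrec_cons (Primrec.id.pair (Primrec.const true)) (primrec_cons
      (Primrec.id.pair (Primrec.const false)) (Primrec.const []))).to_comp
  · refine SemiDec.exists (p := fun x : List (HenkinAtom × Bool) × ℕ =>
      A x.2 ∧ [(truthAtom x.2 [], false)] = x.1) ((hA.comp Computable.snd).and
        (semiDec_of_primrecPred (Primrec.eq.comp ?_ Primrec.fst)))
    exact primrec_cons ((primrec_truthAtom Primrec.snd (Primrec.const [])).pair
      (Primrec.const false)) (Primrec.const [])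
  · have key : ∀ L : List (ClauseParam → List (HenkinAtom × Bool)), (∀ g ∈ L, Primrec g) →
        SemiDec fun Δ => ∃ g ∈ L, ∃ p, g p = Δ := by
      intro L hL
      induction L with
      | nil => exact (semiDec_of_primrecPred (PrimrecPred.not (Primrec.eq.comp
          (Primrec.id) Primrec.id))).of_iff fun a => by simp
      | cons g L ih =>
        rw [List.forall_mem_cons] at hL
        exact ((semiDec_range hL.1.to_comp).or (ih hL.2)).of_iff fun a => by simp
    exact key _ primrec_henkinSchemes

/-! ### From valuations to structures -/

/-- The closure properties of a valuation which omits all contradictory sets of literals. -/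
structure IsHenkin (v : HenkinAtom → Prop) : Prop where
  falsum : ∀ s, ¬ v (truthAtom 0 s)
  imp : ∀ a b s, v (truthAtom (Nat.pair 3 (Nat.pair a b)) s) ↔
    (v (truthAtom a s) → v (truthAtom b s))
  all : ∀ a s, v (truthAtom (Nat.pair 4 a) s) ↔ ∀ k, v (truthAtom a (s ++ [k]))
  equal : ∀ a b s, v (truthAtom (Nat.pair 1 (Nat.pair a b)) s) ↔
    v (nameAtom (termName a s) (termName b s))
  refl : ∀ a, v (nameAtom a a)
  eucl : ∀ a b c, v (nameAtom a b) → v (nameAtom c b) → v (nameAtom a c)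
  var : ∀ i s, v (nameAtom (termName (Nat.pair 0 i) s) (s.getD i 0))
  nil : ∀ s s', v (listAtom 0 s 0 s')
  cons : ∀ a l s b l' s', v (nameAtom (termName a s) (termName b s')) → v (listAtom l s l' s') →
    v (listAtom (Nat.succ (Nat.pair a l)) s (Nat.succ (Nat.pair b l')) s')
  func : ∀ f l s l' s', v (listAtom l s l' s') →
    v (nameAtom (termName (Nat.pair 1 (Nat.pair f l)) s) (termName (Nat.pair 1 (Nat.pair f l')) s'))
  rel : ∀ r l s l' s', v (listAtom l s l' s') →
    v (truthAtom (Nat.pair 2 (Nat.pair r l)) s) → v (truthAtom (Nat.pair 2 (Nat.pair r l')) s')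

theorem isHenkin_of_schemes {v : HenkinAtom → Prop}
    (h : ∀ g ∈ henkinSchemes, ∀ p, ∃ x ∈ g p, ¬ Holds v x) : IsHenkin v := by
  simp only [henkinSchemes, List.forall_mem_cons] at h
  simp only [Holds, List.mem_cons, exists_eq_or_imp,
    List.not_mem_nil, or_false, Bool.false_eq_true, iff_false, iff_true,
    not_not, exists_eq_left] at h
  obtain ⟨h0, h1, h2, h3, h4, h5, h6, h7, h8, h9, h10, h11, h12, h13, h14, -⟩ := h
  -- All schemes share one parameter type; the zeros and empty lists fill coordinates that the
  -- scheme does not read.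
  refine ⟨fun s => h0 ((0, 0, 0), s, []), fun a b s => ?_, fun a s => ?_, fun a b s => ?_,
    fun a => h8 ((a, 0, 0), [], []), fun a b c => ?_, fun i s => h10 ((i, 0, 0), s, []),
    fun s s' => h11 ((0, 0, 0), s, s'), fun a l s b l' s' => ?_, fun f l s l' s' => ?_,
    fun r l s l' s' => ?_⟩
  · have i1 := h1 ((a, b, 0), s, [])
    have i2 := h2 ((a, b, 0), s, [])
    have i3 := h3 ((a, b, 0), s, [])
    dsimp only at i1 i2 i3
    tauto
  · have i1 := fun k => h4 ((a, k, 0), s, [])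
    have i2 := h5 ((a, 0, 0), s, [])
    dsimp only at i1 i2
    constructor
    · intro hv k
      exact (i1 k).resolve_left (not_not.2 hv)
    · intro hv
      -- Truth at the single witness name already forces the universal formula.
      exact i2.resolve_right (not_not.2 (hv _))
  · have i1 := h6 ((a, b, 0), s, [])
    have i2 := h7 ((a, b, 0), s, [])
    dsimp only at i1 i2
    tauto
  · have i1 := h9 ((a, b, c), [], [])
    dsimp only at i1
    tauto
  · have i1 := h12 ((Nat.pair a l, Nat.pair b l', 0), s, s')
    -- This scheme needs four numbers, so they are packed into two pairs; the successor of a pair is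
    -- the code of a nonempty list.
    simp only [Nat.unpair_pair] at i1
    tauto
  · have i1 := h13 ((l, l', f), s, s')
    dsimp only at i1
    tauto
  · have i1 := h14 ((l, l', r), s, s')
    dsimp only at i1
    tauto

namespace IsHenkin

variable {v : HenkinAtom → Prop}

theorem symm (hv : IsHenkin v) {a b : ℕ} (h : v (nameAtom a b)) : v (nameAtom b a) :=
  hv.eucl _ _ _ (hv.refl b) h

theorem trans (hv : IsHenkin v) {a b c : ℕ} (h : v (nameAtom a b)) (h' : v (nameAtom b c)) :
    v (nameAtom a c) :=
  hv.eucl _ _ _ h (hv.symm h')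

theorem ofFn (hv : IsHenkin v) {n : ℕ} {f g : Fin n → ℕ} {s s' : List ℕ}
    (h : ∀ i, v (nameAtom (termName (f i) s) (termName (g i) s'))) :
    v (listAtom (Encodable.encode (List.ofFn f)) s (Encodable.encode (List.ofFn g)) s') := by
  induction n with
  | zero => simpa using hv.nil s s'
  | succ n ih =>
    simp only [List.ofFn_succ, Encodable.encode_list_cons]
    exact hv.cons _ _ _ _ _ _ (h 0) (ih fun i => h i.succ)

theorem var_ofFn (hv : IsHenkin v) {n : ℕ} (x : Fin n → ℕ) (i : Fin n) :
    v (nameAtom (termName (Nat.pair 0 i) (List.ofFn x)) (x i)) := by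
  simpa [List.getD_eq_getElem?_getD] using hv.var i (List.ofFn x)

/-- Equality of names is an equivalence relation. -/
def setoid (hv : IsHenkin v) : Setoid ℕ :=
  ⟨fun a b => v (nameAtom a b), hv.refl, hv.symm, hv.trans⟩

/-- The term model of a valuation. -/
def TermModel (hv : IsHenkin v) : Type := Quotient hv.setoid

/-- The element of the term model with the given name. -/
def cls (hv : IsHenkin v) (a : ℕ) : TermModel hv := Quotient.mk hv.setoid a

theorem cls_eq_cls (hv : IsHenkin v) {a b : ℕ} :
    hv.cls a = hv.cls b ↔ v (nameAtom a b) :=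
  Quotient.eq (r := hv.setoid)

/-- A name of an element of the term model. -/
noncomputable def name (hv : IsHenkin v) (q : TermModel hv) : ℕ := Quotient.out q

theorem cls_name (hv : IsHenkin v) (q : TermModel hv) : hv.cls (hv.name q) = q :=
  Quotient.out_eq q

variable {L : FirstOrder.Language.{u, v}} (ν : Numbering L)

/-- The interpretation of the symbols of the language in the term model. -/
@[reducible] noncomputable def termStructure (hv : IsHenkin v) : L.Structure (TermModel hv) where
  funMap {n} F x := hv.cls (termName (Nat.pair 1 (Nat.pair (ν.fn ⟨n, F⟩)
    (Encodable.encode (List.ofFn fun i : Fin n => Nat.pair 0 i)))) (List.ofFn fun i => hv.name (x i)))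
  RelMap {n} R x := v (truthAtom (Nat.pair 2 (Nat.pair (ν.rel ⟨n, R⟩)
    (Encodable.encode (List.ofFn fun i : Fin n => Nat.pair 0 i)))) (List.ofFn fun i => hv.name (x i)))

/-- The term model interprets a symbol by applying it to variables under an assignment of chosen
names. This comparison with the actual arguments allows the congruence clauses to be used. -/
theorem listAtom_vars (hv : IsHenkin v) {n : ℕ} {f : Fin n → ℕ} {s : List ℕ} {x : Fin n → TermModel hv}
    (h : ∀ i, x i = hv.cls (termName (f i) s)) :
    v (listAtom (Encodable.encode (List.ofFn fun i : Fin n => Nat.pair 0 i))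
      (List.ofFn fun i => hv.name (x i)) (Encodable.encode (List.ofFn f)) s) :=
  hv.ofFn fun i => hv.trans (hv.var_ofFn (fun i => hv.name (x i)) i)
    (hv.cls_eq_cls.1 ((hv.cls_name (x i)).trans (h i)))

theorem realize_term (hv : IsHenkin v) {n : ℕ} (e : Empty → TermModel hv) (x : Fin n → ℕ)
    (t : L.Term (Empty ⊕ Fin n)) :
    letI := hv.termStructure ν
    t.realize (Sum.elim e fun i => hv.cls (x i)) =
      hv.cls (termName (termCode ν t) (List.ofFn x)) := by
  let _ := hv.termStructure ν
  induction t with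
  | var a =>
    rcases a with a | i
    · exact a.elim
    · exact (hv.cls_eq_cls.2 (hv.var_ofFn x i)).symm
  | func F ts ih =>
    rw [Term.realize_func]
    exact hv.cls_eq_cls.2 (hv.func _ _ _ _ _ (hv.listAtom_vars ih))

theorem realize_formula (hv : IsHenkin v) {n : ℕ} (e : Empty → TermModel hv) (x : Fin n → ℕ)
    (φ : L.BoundedFormula Empty n) :
    letI := hv.termStructure ν
    φ.Realize e (fun i => hv.cls (x i)) ↔
      v (truthAtom (formulaCode ν φ) (List.ofFn x)) := by
  let _ := hv.termStructure ν
  induction φ with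
  | falsum => exact iff_of_false id (hv.falsum _)
  | equal s t =>
    rw [formulaCode, hv.equal, ← hv.cls_eq_cls, ← hv.realize_term ν e, ← hv.realize_term ν e]
    rfl
  | @rel n k R ts =>
    have h := hv.listAtom_vars (fun i => hv.realize_term ν e x (ts i))
    -- The congruence clause for relations goes in one direction only, hence the comparison of lists
    -- in the other order.
    have h' : v (listAtom (Encodable.encode (List.ofFn fun i => termCode ν (ts i))) (List.ofFn x)
        (Encodable.encode (List.ofFn fun i : Fin k => Nat.pair 0 i)) (List.ofFn fun i =>
          hv.name ((ts i).realize (Sum.elim e fun i => hv.cls (x i))))) :=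
      hv.ofFn fun i => hv.symm (hv.trans (hv.var_ofFn (fun i => hv.name _) i)
        (hv.cls_eq_cls.1 ((hv.cls_name _).trans (hv.realize_term ν e x (ts i)))))
    exact ⟨hv.rel _ _ _ _ _ h, hv.rel _ _ _ _ _ h'⟩
  | imp φ ψ ih ih' =>
    rw [formulaCode, hv.imp]
    exact imp_congr (ih x) (ih' x)
  | @all n φ ih =>
    rw [formulaCode, hv.all, BoundedFormula.realize_all]
    -- Every element of the term model has a name, so it is enough to quantify over names.
    have key : ∀ k : ℕ, φ.Realize e (Fin.snoc (fun i => hv.cls (x i))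
        (hv.cls k)) ↔ v (truthAtom (formulaCode ν φ) (List.ofFn x ++ [k])) := by
      intro k
      have h1 : List.ofFn x ++ [k] = List.ofFn (Fin.snoc x k : Fin (n + 1) → ℕ) := by
        rw [List.ofFn_succ', List.concat_eq_append]
        simp
      rw [h1]
      refine Iff.trans (iff_of_eq (congrArg _ (funext fun i => ?_))) (ih _)
      refine Fin.lastCases ?_ (fun i => ?_) i <;> simp
    exact ⟨fun h k => (key k).1 (h _), fun h q => hv.cls_name q ▸ (key _).2 (h _)⟩

end IsHenkin

/-- The completeness half: the term model of a valuation that omits all clauses and makes `σ` false.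
-/
theorem exists_model_of_not_refuted {L : FirstOrder.Language.{u, v}} (ν : Numbering L)
    {T : L.Theory} {σ : L.Sentence}
    (h : ¬ Refuted (HenkinClause fun c => ∃ τ ∈ T, formulaCode ν τ = c)
      [(truthAtom (formulaCode ν σ) [], false)]) :
    ∃ (M : Type) (_ : L.Structure M), Nonempty M ∧ M ⊨ T ∧ ¬ M ⊨ σ := by
  obtain ⟨v, hσ, hC⟩ := exists_holds_of_not_refuted (fun a => .inl ⟨a, rfl⟩) h
  have hv : IsHenkin v := isHenkin_of_schemes fun g hg p => hC _ (.inr (.inr ⟨g, hg, p, rfl⟩))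
  let _ := hv.termStructure ν
  have key : ∀ φ : L.Sentence, hv.TermModel ⊨ φ ↔ v (truthAtom (formulaCode ν φ) []) := by
    intro φ
    rw [Sentence.Realize, Formula.Realize]
    have := hv.realize_formula ν default Fin.elim0 φ
    rw [List.ofFn_zero] at this
    rw [← this]
    exact iff_of_eq (congrArg _ (Subsingleton.elim _ _))
  refine ⟨hv.TermModel, _, ⟨hv.cls 0⟩, ⟨fun τ hτ => (key τ).2 ?_⟩, fun hM => ?_⟩
  · obtain ⟨x, hx, hx'⟩ := hC _ (.inr (.inl ⟨_, ⟨τ, hτ, rfl⟩, rfl⟩))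
    rw [List.mem_singleton] at hx
    subst hx
    simpa [Holds] using hx'
  · have := hσ _ (List.mem_singleton.2 rfl)
    simp only [Holds, Bool.false_eq_true, iff_false] at this
    exact this ((key σ).1 hM)

/-! ### From structures to valuations -/

theorem lt_of_mem_ofNat_list {a n : ℕ} (h : a ∈ Denumerable.ofNat (List ℕ) n) : a < n := by
  have key : ∀ l : List ℕ, a ∈ l → a < Encodable.encode l := by
    intro l hl
    induction l with
    | nil => simp at hl
    | cons b l ih =>
      rw [Encodable.encode_list_cons, Nat.lt_succ_iff]
      rcases List.mem_cons.1 hl with rfl | hl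
      · exact Nat.left_le_pair _ _
      · exact (ih hl).le.trans (Nat.right_le_pair _ _)
  simpa using key _ h

theorem lt_pair_pair {a i b n : ℕ} (h : a < n) : a < Nat.pair i (Nat.pair b n) :=
  h.trans_le ((Nat.right_le_pair _ _).trans (Nat.right_le_pair _ _))

/-! ### Evaluation of codes in a structure -/

section Eval

variable {L : FirstOrder.Language.{u, v}} (ν : Numbering L) {M : Type w} [L.Structure M]

/-- The truth of the relation symbol with the given code at a list of arguments. -/
def relEval (c : ℕ) (xs : List M) : Prop :=
  ∃ R : L.Relations xs.length, ν.rel ⟨_, R⟩ = c ∧ Structure.RelMap R xs.get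

/-- The arity is read off from the length of the list. Injectivity of the numbering on symbols
together with their arities leaves `R` as the only candidate; the detour over a general list of
length `n` avoids a dependent rewriting. -/
theorem relEval_ofFn {n : ℕ} (R : L.Relations n) (x : Fin n → M) :
    relEval ν (ν.rel ⟨n, R⟩) (List.ofFn x) ↔ Structure.RelMap R x := by
  have key : ∀ (xs : List M) (h : xs.length = n), relEval ν (ν.rel ⟨n, R⟩) xs ↔
      Structure.RelMap R fun i => xs.get (i.cast h.symm) := by
    rintro xs rfl
    constructor
    · rintro ⟨S, hS, h⟩
      rw [eq_of_heq (Sigma.mk.inj (ν.rel_injective hS)).2] at h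
      exact h
    · exact fun h => ⟨R, rfl, h⟩
  rw [key _ List.length_ofFn]
  simp

variable [Inhabited M]

open Classical in
/-- The value of the function symbol with the given code at a list of arguments. -/
noncomputable def funEval (c : ℕ) (xs : List M) : M :=
  if h : ∃ F : L.Functions xs.length, ν.fn ⟨_, F⟩ = c then Structure.funMap h.choose xs.get
  else default

theorem funEval_ofFn {n : ℕ} (F : L.Functions n) (x : Fin n → M) :
    funEval ν (ν.fn ⟨n, F⟩) (List.ofFn x) = Structure.funMap F x := by
  have key : ∀ (xs : List M) (h : xs.length = n), funEval ν (ν.fn ⟨n, F⟩) xs =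
      Structure.funMap F fun i => xs.get (i.cast h.symm) := by
    rintro xs rfl
    have h : ∃ G : L.Functions xs.length, ν.fn ⟨_, G⟩ = ν.fn ⟨_, F⟩ := ⟨F, rfl⟩
    rw [funEval, dif_pos h, eq_of_heq (Sigma.mk.inj (ν.fn_injective h.choose_spec)).2]
    rfl
  rw [key _ List.length_ofFn]
  simp

/-- The value of the term with the given code under an assignment. -/
noncomputable def termEval (s : List M) (c : ℕ) : M :=
  if c.unpair.1 = 0 then s.getD c.unpair.2 default
  else funEval ν c.unpair.2.unpair.1
    ((Denumerable.ofNat (List ℕ) c.unpair.2.unpair.2).map fun t =>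
      if _h : t < c then termEval s t else default)
termination_by c

/-- The values of the list of terms with the given code. -/
noncomputable def listEval (s : List M) (l : ℕ) : List M :=
  (Denumerable.ofNat (List ℕ) l).map (termEval ν s)

theorem termEval_var (s : List M) (i : ℕ) : termEval ν s (Nat.pair 0 i) = s.getD i default := by
  rw [termEval]
  simp

theorem termEval_func (s : List M) (f l : ℕ) :
    termEval ν s (Nat.pair 1 (Nat.pair f l)) = funEval ν f (listEval ν s l) := by
  rw [termEval]
  simp only [Nat.unpair_pair, one_ne_zero, if_false, listEval]
  congr 1
  refine List.map_congr_left fun t ht => ?_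
  rw [dif_pos (lt_pair_pair (lt_of_mem_ofNat_list ht))]

theorem listEval_zero (s : List M) : listEval ν s 0 = [] := by
  simp [listEval]

theorem listEval_succ (s : List M) (n : ℕ) : listEval ν s n.succ =
    termEval ν s n.unpair.1 :: listEval ν s n.unpair.2 := by
  simp [listEval]

/-- The truth of the formula with the given code under an assignment. -/
def formulaEval (c : ℕ) (s : List M) : Prop :=
  if c.unpair.1 = 1 then termEval ν s c.unpair.2.unpair.1 = termEval ν s c.unpair.2.unpair.2
  else if c.unpair.1 = 2 then relEval ν c.unpair.2.unpair.1 (listEval ν s c.unpair.2.unpair.2)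
  else if _h : c.unpair.1 = 3 then
    formulaEval c.unpair.2.unpair.1 s → formulaEval c.unpair.2.unpair.2 s
  else if _h : c.unpair.1 = 4 then ∀ x, formulaEval c.unpair.2 (s ++ [x])
  else False
termination_by c
decreasing_by
  · have := Nat.unpair_add_le c
    have := Nat.unpair_left_le c.unpair.2
    omega
  · have := Nat.unpair_add_le c
    have := Nat.unpair_right_le c.unpair.2
    omega
  · have := Nat.unpair_add_le c
    omega

theorem formulaEval_zero (s : List M) : ¬ formulaEval ν 0 s := by
  rw [formulaEval]
  simp

theorem formulaEval_equal (a b : ℕ) (s : List M) :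
    formulaEval ν (Nat.pair 1 (Nat.pair a b)) s ↔ termEval ν s a = termEval ν s b := by
  rw [formulaEval]
  simp

theorem formulaEval_rel (r l : ℕ) (s : List M) :
    formulaEval ν (Nat.pair 2 (Nat.pair r l)) s ↔ relEval ν r (listEval ν s l) := by
  rw [formulaEval]
  simp

theorem formulaEval_imp (a b : ℕ) (s : List M) :
    formulaEval ν (Nat.pair 3 (Nat.pair a b)) s ↔ (formulaEval ν a s → formulaEval ν b s) := by
  rw [formulaEval]
  simp

theorem formulaEval_all (a : ℕ) (s : List M) :
    formulaEval ν (Nat.pair 4 a) s ↔ ∀ x, formulaEval ν a (s ++ [x]) := by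
  rw [formulaEval]
  simp

theorem listEval_ofFn {n : ℕ} (f : Fin n → ℕ) (s : List M) :
    listEval ν s (Encodable.encode (List.ofFn f)) = List.ofFn fun i => termEval ν s (f i) := by
  simp [listEval, Function.comp_def]

theorem termEval_termCode {n : ℕ} (e : Empty → M) (x : Fin n → M) (t : L.Term (Empty ⊕ Fin n)) :
    termEval ν (List.ofFn x) (termCode ν t) = t.realize (Sum.elim e x) := by
  induction t with
  | var a =>
    rcases a with a | i
    · exact a.elim
    · rw [termCode, termEval_var]
      simp [List.getD_eq_getElem?_getD]
  | func F ts ih =>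
    rw [termCode, termEval_func, listEval_ofFn, funEval_ofFn, Term.realize_func]
    exact congrArg _ (funext ih)

theorem formulaEval_formulaCode {n : ℕ} (e : Empty → M) (x : Fin n → M)
    (φ : L.BoundedFormula Empty n) :
    formulaEval ν (formulaCode ν φ) (List.ofFn x) ↔ φ.Realize e x := by
  induction φ with
  | falsum => exact iff_of_false (formulaEval_zero ν _) id
  | equal s t =>
    rw [formulaCode, formulaEval_equal, termEval_termCode ν e, termEval_termCode ν e]
    rfl
  | rel R ts =>
    rw [formulaCode, formulaEval_rel, listEval_ofFn, relEval_ofFn]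
    exact iff_of_eq (congrArg _ (funext fun i => termEval_termCode ν e x (ts i)))
  | imp φ ψ ih ih' =>
    rw [formulaCode, formulaEval_imp]
    exact imp_congr (ih x) (ih' x)
  | @all n φ ih =>
    rw [formulaCode, formulaEval_all, BoundedFormula.realize_all]
    refine forall_congr' fun a => ?_
    rw [← ih, List.ofFn_succ', List.concat_eq_append]
    simp

/-- The element denoted by a name. -/
noncomputable def nameEval (n : ℕ) : M :=
  let s : List M := (Denumerable.ofNat (List ℕ) n.unpair.2.unpair.2).map fun a =>
    if _h : a < n then nameEval a else default
  if n.unpair.1 = 0 then termEval ν s n.unpair.2.unpair.1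
  else Classical.epsilon fun x => ¬ formulaEval ν n.unpair.2.unpair.1 (s ++ [x])
termination_by n

/-- The guard in the recursion is always satisfied, since the entries of a list are smaller than the
code of any name built from it. -/
theorem map_nameEval (i c : ℕ) (s : List ℕ) :
    (s.map fun a => if _h : a < Nat.pair i (Nat.pair c (Encodable.encode s))
      then nameEval ν a else (default : M)) = s.map (nameEval ν) := by
  refine List.map_congr_left fun t ht => ?_
  rw [dif_pos (lt_pair_pair (lt_of_mem_ofNat_list (by simpa using ht)))]

theorem nameEval_termName (t : ℕ) (s : List ℕ) :
    (nameEval ν (termName t s) : M) = termEval ν (s.map (nameEval ν)) t := by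
  rw [termName, nameEval]
  simp only [Nat.unpair_pair, Denumerable.ofNat_encode, map_nameEval, if_true]

theorem formulaEval_witnessName {c : ℕ} {s : List ℕ}
    (h : formulaEval ν c (s.map (nameEval ν) ++ [(nameEval ν (witnessName c s) : M)])) (x : M) :
    formulaEval ν c (s.map (nameEval ν) ++ [x]) := by
  by_contra hx
  have h' : ∃ x : M, ¬ formulaEval ν c (s.map (nameEval ν) ++ [x]) := ⟨x, hx⟩
  refine Classical.epsilon_spec h' ?_
  rw [witnessName, nameEval] at h
  simp only [Nat.unpair_pair, Denumerable.ofNat_encode, map_nameEval, one_ne_zero, if_false] at h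
  exact h

/-- The number 0 codes the variable 0 under the empty assignment. The scheme for variables uses the
name 0 outside the assignment, so it has to denote the default element used by `termEval`. -/
theorem nameEval_zero : (nameEval ν 0 : M) = default := by
  rw [nameEval]
  simp only [Nat.unpair_zero, Prod.fst_zero, Prod.snd_zero, if_true, Denumerable.list_ofNat_zero,
    List.map_nil]
  rw [termEval]
  simp

variable (M) in
/-- The valuation given by a structure. -/
def valuation (a : HenkinAtom) : Prop :=
  match a.1 with
  | 0 => formulaEval ν a.2.1.1 (a.2.1.2.map (nameEval ν) : List M)
  | 1 => (nameEval ν a.2.1.1 : M) = nameEval ν a.2.2.1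
  | _ => listEval ν (a.2.1.2.map (nameEval ν) : List M) a.2.1.1 =
      listEval ν (a.2.2.2.map (nameEval ν)) a.2.2.1

-- The evaluations are total on numbers, including those that code no term or formula, so Tarski's
-- clauses hold for every choice of parameters.
variable (M) in
theorem exists_not_holds_valuation : ∀ g ∈ henkinSchemes, ∀ p, ∃ x ∈ g p,
    ¬ Holds (valuation ν M) x := by
  simp only [henkinSchemes, List.forall_mem_cons]
  simp only [Holds, List.mem_cons, exists_eq_or_imp, List.not_mem_nil, or_false,
    Bool.false_eq_true, iff_false, iff_true, not_not, exists_eq_left, truthAtom, nameAtom, listAtom,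
    valuation, formulaEval_zero, formulaEval_imp, formulaEval_equal, formulaEval_all,
    formulaEval_rel, nameEval_termName, termEval_func, termEval_var, listEval_zero, listEval_succ,
    List.map_append, List.map_cons, List.map_nil]
  refine ⟨fun p => id, fun p => ?_, fun p => ?_, fun p => ?_, fun p => ?_, fun p => ?_, fun p => ?_,
    fun p => ?_, fun p => trivial, fun p => ?_, fun p => ?_, fun p => trivial, fun p => ?_, fun p => ?_,
    fun p => ?_, fun _ h => h.elim⟩
  · tauto
  · tauto
  · tauto
  · exact (em _).elim (fun h => .inr (h _)) .inl
  -- The witness name denotes a counterexample whenever there is one.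
  · exact (em _).elim (fun h => .inl fun x => formulaEval_witnessName ν h x) .inr
  · tauto
  · tauto
  · exact or_iff_not_imp_left.2 fun h => or_iff_not_imp_left.2 fun h' =>
      (not_not.1 h).trans (not_not.1 h').symm
  · rw [← nameEval_zero ν, List.getD_map]
  · rw [List.cons.injEq]
    tauto
  · exact or_iff_not_imp_left.2 fun h => by rw [not_not.1 h]
  · exact or_iff_not_imp_left.2 fun h => by rw [not_not.1 h]; exact (em _).symm

end Eval

/-- Left to right is completeness by the term model. Right to left, each model of `T` gives a
valuation omitting all clauses, so a refutation leaves no room for `σ` to be false in it. -/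
theorem models_iff_refuted {L : FirstOrder.Language.{u, v}} (ν : Numbering L) {T : L.Theory}
    {σ : L.Sentence} : T ⊨ᵇ σ ↔ Refuted (HenkinClause fun c => ∃ τ ∈ T, formulaCode ν τ = c)
      [(truthAtom (formulaCode ν σ) [], false)] := by
  constructor
  · intro h
    by_contra hn
    obtain ⟨M, _, _, _, hM⟩ := exists_model_of_not_refuted ν hn
    exact hM (h.realize_sentence M)
  · intro h
    rw [Theory.models_sentence_iff]
    intro M
    have : Inhabited M := Classical.inhabited_of_nonempty inferInstance
    have key : ∀ φ : L.Sentence, valuation ν M (truthAtom (formulaCode ν φ) []) ↔ M ⊨ φ :=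
      fun φ => formulaEval_formulaCode ν (@default _ Unique.instInhabited)
        (@default _ Unique.instInhabited) φ
    obtain ⟨x, hx, hx'⟩ := h.exists_not_holds (v := valuation ν M) (by
      rintro Δ (⟨a, rfl⟩ | ⟨_, ⟨τ, hτ, rfl⟩, rfl⟩ | ⟨g, hg, p, rfl⟩)
      · by_cases ha : valuation ν M a
        · exact ⟨(a, false), by simp, by simpa [Holds] using ha⟩
        · exact ⟨(a, true), by simp, by simpa [Holds] using ha⟩
      · refine ⟨_, List.mem_singleton.2 rfl, ?_⟩
        simpa [Holds, key] using Theory.realize_sentence_of_mem T hτ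
      · exact exists_not_holds_valuation ν M g hg p)
    rw [List.mem_singleton] at hx
    subst hx
    simpa [Holds, key] using hx'

/-- The set of (codes of) consequences of a recursive theory is recursively enumerable. -/
theorem IsRecursive.semiDec_models {L : FirstOrder.Language.{u, v}} {ν : Numbering L} {T : L.Theory}
    (hT : IsRecursive ν T) :
    ∃ p : ℕ → Prop, SemiDec p ∧ ∀ σ : L.Sentence, T ⊨ᵇ σ ↔ p (formulaCode ν σ) := by
  refine ⟨_, SemiDec.comp (SemiDec.refuted (SemiDec.henkinClause (semiDec_of_computablePred hT)))
    (g := fun c => [(truthAtom c [], false)]) (Primrec.to_comp ?_),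
    fun σ => models_iff_refuted ν⟩
  exact primrec_cons ((primrec_truthAtom Primrec.id (Primrec.const [])).pair
    (Primrec.const false)) (Primrec.const [])

/-! ### Craig's trick -/

theorem computable_boundedExists {g : ℕ × ℕ → Bool} (hg : Computable g) {N : ℕ → ℕ}
    (hN : Computable N) : ComputablePred fun c => ∃ i < N c, g (c, i) = true := by
  classical
  have h := Computable.nat_rec hN (Computable.const (α := ℕ) false)
    (h := fun c x => x.2 || g (c, x.1)) (Primrec.or.to_comp.comp
      (Computable.snd.comp Computable.snd)
      (hg.comp (Computable.fst.pair (Computable.fst.comp Computable.snd)))).to₂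
  have key : ∀ c n, (Nat.rec false (fun i r => r || g (c, i)) n : Bool) = true ↔
      ∃ i < n, g (c, i) = true := by
    intro c n
    induction n with
    | zero => simp
    | succ n ih => simp only [Bool.or_eq_true, ih, Nat.exists_lt_succ_right]
  refine Computable.computablePred (h.of_eq fun c => ?_)
  rw [Bool.eq_iff_iff, key, decide_eq_true_iff]

theorem ComputablePred.or' {p q : ℕ → Prop} (hp : ComputablePred p) (hq : ComputablePred q) :
    ComputablePred fun c => p c ∨ q c := by
  classical
  refine Computable.computablePred ((Primrec.or.to_comp.comp hp.decide hq.decide).of_eq fun c => ?_)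
  simp

/-- The code of `ψ ⟹ (ψ ⟹ ⋯ ⟹ φ)`, where `t` is the code of `ψ` and `c` is the code of `φ`. -/
def padCode (t k c : ℕ) : ℕ := (fun x => Nat.pair 3 (Nat.pair t x))^[k] c

theorem primrec_padCode (t : ℕ) : Primrec₂ (padCode t) :=
  Primrec.nat_iterate Primrec.fst Primrec.snd (Primrec₂.natPair.comp (Primrec.const 3)
    (Primrec₂.natPair.comp (Primrec.const _) Primrec.snd)).to₂

theorem add_le_padCode (t k c : ℕ) : k + c ≤ padCode t k c := by
  induction k with
  | zero => simp [padCode]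
  | succ k ih =>
    rw [padCode, Function.iterate_succ_apply', ← padCode]
    have h1 := Nat.right_le_pair t (padCode t k c)
    have h2 := Nat.add_le_pair 3 (Nat.pair t (padCode t k c))
    omega

/-- Padding increases codes: both the number of paddings and the original code are bounded by the
code `c`, so a bounded search decides the predicate. -/
theorem computablePred_padCode {f : ℕ × ℕ → Bool} (hf : Computable f) (t : ℕ) :
    ComputablePred fun c => ∃ k d, padCode t k d = c ∧ f (d, k) = true := by
  have hg : Computable fun x : ℕ × ℕ => decide (padCode t x.2.unpair.1 x.2.unpair.2 = x.1) &&
      f (x.2.unpair.2, x.2.unpair.1) := by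
    have u := Computable.unpair.comp (Computable.snd (α := ℕ) (β := ℕ))
    have he : Computable fun x : ℕ × ℕ => decide (x.1 = x.2) :=
      (PrimrecPred.decide (p := fun x : ℕ × ℕ => x.1 = x.2) Primrec.eq).to_comp
    have hp : Computable fun x : ℕ × ℕ => (padCode t x.2.unpair.1 x.2.unpair.2, x.1) :=
      ((primrec_padCode t).to_comp.comp (Computable.fst.comp u) (Computable.snd.comp u)).pair
        Computable.fst
    have hf' : Computable fun x : ℕ × ℕ => f (x.2.unpair.2, x.2.unpair.1) :=
      hf.comp ((Computable.snd.comp u).pair (Computable.fst.comp u))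
    have h1 := he.comp hp
    exact Primrec.and.to_comp.comp h1 hf'
  -- With `k` and `d` at most `c`, the pairing of `k` and `d` stays below `(c + 1) ^ 2`.
  refine (computable_boundedExists hg (N := fun c => (c + 1) * (c + 1)) ?_).of_eq fun c => ?_
  · exact (Primrec.nat_mul.comp Primrec.succ Primrec.succ).to_comp
  · simp only [Bool.and_eq_true, decide_eq_true_eq]
    constructor
    · rintro ⟨i, -, h⟩
      exact ⟨_, _, h⟩
    · rintro ⟨k, d, rfl, h⟩
      have hle := add_le_padCode t k d
      refine ⟨Nat.pair k d, ?_, by rw [Nat.unpair_pair], by rwa [Nat.unpair_pair]⟩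
      refine (Nat.pair_lt_max_add_one_sq _ _).trans_le ?_
      rw [sq]
      exact Nat.mul_le_mul (by omega) (by omega)

/-! ### Padded axioms -/

section Pad

variable {L : FirstOrder.Language.{u, v}}

/-- The sentence `⊤ ⟹ (⊤ ⟹ ⋯ ⟹ σ)`. -/
def padSentence (k : ℕ) (σ : L.Sentence) : L.Sentence := (fun φ => (⊤ : L.Sentence).imp φ)^[k] σ

theorem formulaCode_padSentence (ν : Numbering L) (k : ℕ) (σ : L.Sentence) :
    formulaCode ν (padSentence k σ) =
      padCode (formulaCode ν (⊤ : L.Sentence)) k (formulaCode ν σ) := by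
  induction k with
  | zero => rfl
  | succ k ih =>
    rw [padSentence, padCode, Function.iterate_succ_apply', Function.iterate_succ_apply',
      ← padSentence, ← padCode, ← ih, formulaCode]

theorem realize_padSentence (k : ℕ) (σ : L.Sentence) (M : Type w) [L.Structure M] :
    M ⊨ padSentence k σ ↔ M ⊨ σ := by
  induction k with
  | zero => rfl
  | succ k ih =>
    rw [padSentence, Function.iterate_succ_apply', ← padSentence, ← ih]
    simp [Sentence.Realize, Formula.Realize]

/-- Craig's trick: an axiom is padded as many times as the value of a certificate for its
membership, so that membership can be checked from the padded sentence alone. Padding by `⊤` does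
not change the models. -/
theorem exists_isRecursive (ν : Numbering L) {S : L.Theory}
    (hS : SemiDec fun c => ∃ σ ∈ S, formulaCode ν σ = c) :
    ∃ S' : L.Theory, IsRecursive ν S' ∧
      ∀ (M : Type w) [L.Structure M], M ⊨ S' ↔ M ⊨ S := by
  obtain ⟨f, hf, h⟩ := hS
  refine ⟨{φ | ∃ σ ∈ S, ∃ k, f (formulaCode ν σ, k) = true ∧ φ = padSentence k σ},
    (computablePred_padCode hf (formulaCode ν (⊤ : L.Sentence))).of_eq fun c => ?_, fun M _ => ?_⟩
  · constructor
    · rintro ⟨k, d, rfl, hk⟩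
      obtain ⟨σ, hσ, rfl⟩ := (h _).2 ⟨_, hk⟩
      exact ⟨_, ⟨σ, hσ, k, hk, rfl⟩, formulaCode_padSentence ν k σ⟩
    · rintro ⟨_, ⟨σ, hσ, k, hk, rfl⟩, rfl⟩
      exact ⟨k, _, (formulaCode_padSentence ν k σ).symm, hk⟩
  · simp only [Theory.model_iff]
    constructor
    · intro hM σ hσ
      obtain ⟨k, hk⟩ := (h _).1 ⟨σ, hσ, rfl⟩
      exact (realize_padSentence k σ M).1 (hM _ ⟨σ, hσ, k, hk, rfl⟩)
    · rintro hM _ ⟨σ, hσ, k, hk, rfl⟩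
      exact (realize_padSentence k σ M).2 (hM σ hσ)

end Pad

theorem IsRecursive.union {L : FirstOrder.Language.{u, v}} {ν : Numbering L} {S S' : L.Theory}
    (h : IsRecursive ν S) (h' : IsRecursive ν S') : IsRecursive ν (S ∪ S') :=
  (ComputablePred.or' h h').of_eq fun c => by
    simp only [Set.mem_union, or_and_right, exists_or]

/-! ### Codes of quantifier-free formulas -/

theorem SemiDec.image {α β : Type*} [Primcodable α] [Primcodable β] {p : β → Prop}
    (hp : SemiDec p) {g : β → α} (hg : Computable g) : SemiDec fun a => ∃ b, p b ∧ g b = a := by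
  refine SemiDec.exists (p := fun x : α × β => p x.2 ∧ g x.2 = x.1)
    ((hp.comp Computable.snd).and ?_)
  classical
  have h : PrimrecPred fun x : α × α => x.1 = x.2 := Primrec.eq
  exact semiDec_of_computablePred (Computable.computablePred
    (h.decide.to_comp.comp ((hg.comp Computable.snd).pair Computable.fst)))

/-- The effect of `liftAt 2 k` on variables. -/
def shiftVar (k i : ℕ) : ℕ := if i < k then i else i + 2

theorem primrec_shiftVar {α : Type*} [Primcodable α] {f g : α → ℕ} (hf : Primrec f)
    (hg : Primrec g) : Primrec fun a => shiftVar (f a) (g a) :=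
  Primrec.ite (Primrec.nat_lt.comp hg hf) hg (Primrec.succ.comp (Primrec.succ.comp hg))

/-- Quadruples consisting of a type (`0` for terms, `m + 1` for lists of `m` terms), a pair of
numbers `n`, `k`, the code of a term or list of terms in `n` variables, and the code of its image
under `liftAt 2 k`. -/
abbrev TermData := ℕ × (ℕ × ℕ) × ℕ × ℕ

section Codes

variable {L : FirstOrder.Language.{u, v}} (ν : Numbering L)

/-- The correct quadruples. -/
def IsTermData : TermData → Prop
  | (0, (n, k), c, c') => ∃ t : L.Term (Empty ⊕ Fin n),
      termCode ν t = c ∧ termCode ν (t.liftAt 2 k) = c'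
  | (m + 1, (n, k), c, c') => ∃ ts : Fin m → L.Term (Empty ⊕ Fin n),
      Encodable.encode (List.ofFn fun i => termCode ν (ts i)) = c ∧
      Encodable.encode (List.ofFn fun i => termCode ν ((ts i).liftAt 2 k)) = c'

/-- Variables and the empty list. -/
def TermBase (x : TermData) : Prop :=
  (∃ p : ℕ × ℕ × ℕ, p.1 < p.2.1 ∧
    ((0, p.2, Nat.pair 0 p.1, Nat.pair 0 (shiftVar p.2.2 p.1)) : TermData) = x) ∨
  ∃ p : ℕ × ℕ, ((1, p, 0, 0) : TermData) = x

/-- Adding a term to a list, and applying a function symbol to a list. -/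
def TermStep (x : TermData × TermData × TermData) : Prop :=
  (∃ p : (ℕ × ℕ × ℕ) × (ℕ × ℕ) × (ℕ × ℕ), (((0, p.1.2, p.2.1), (p.1.1 + 1, p.1.2, p.2.2),
    (p.1.1 + 1 + 1, p.1.2, Nat.succ (Nat.pair p.2.1.1 p.2.2.1), Nat.succ (Nat.pair p.2.1.2 p.2.2.2))) :
      TermData × TermData × TermData) = x) ∨
  ∃ p : (ℕ × ℕ) × (ℕ × ℕ) × ℕ × ℕ, (∃ F : L.Functions p.1.2, ν.fn ⟨_, F⟩ = p.1.1) ∧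
    (((p.1.2 + 1, p.2), (p.1.2 + 1, p.2), (0, p.2.1, Nat.pair 1 (Nat.pair p.1.1 p.2.2.1),
      Nat.pair 1 (Nat.pair p.1.1 p.2.2.2))) : TermData × TermData × TermData) = x

theorem termCode_liftAt_var {n k : ℕ} (i : Fin n) :
    termCode ν ((Term.var (Sum.inr i) : L.Term (Empty ⊕ Fin n)).liftAt 2 k) =
      Nat.pair 0 (shiftVar k i) := by
  simp only [Term.liftAt, Term.relabel, Sum.map_inr, termCode, shiftVar]
  split_ifs <;> rfl

/-- Arities are unbounded, so terms and argument lists are generated together, the lists one term at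
a time. The lifted code obeys the same rules and is carried along; this makes lifting available at
the level of codes. -/
theorem isTermData_iff (x : TermData) : IsTermData ν x ↔ Closure TermBase (TermStep ν) x := by
  constructor
  · have hlist : ∀ (n k m : ℕ) (ts : Fin m → L.Term (Empty ⊕ Fin n)),
        (∀ i, Closure TermBase (TermStep ν)
          (0, (n, k), termCode ν (ts i), termCode ν ((ts i).liftAt 2 k))) →
        Closure TermBase (TermStep ν) (m + 1, (n, k),
          Encodable.encode (List.ofFn fun i => termCode ν (ts i)),
          Encodable.encode (List.ofFn fun i => termCode ν ((ts i).liftAt 2 k))) := by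
      intro n k m ts h
      induction m with
      | zero => exact .base (.inr ⟨(n, k), by simp⟩)
      | succ m ih =>
        simp only [List.ofFn_succ, Encodable.encode_list_cons]
        exact .step (h 0) (ih (fun i => ts i.succ) fun i => h i.succ)
          (.inl ⟨((m, n, k), (_, _), (_, _)), rfl⟩)
    have hterm : ∀ (n k : ℕ) (t : L.Term (Empty ⊕ Fin n)), Closure TermBase (TermStep ν)
        (0, (n, k), termCode ν t, termCode ν (t.liftAt 2 k)) := by
      intro n k t
      induction t with
      | var a =>
        rcases a with a | i
        · exact a.elim
        · rw [termCode_liftAt_var]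
          exact .base (.inl ⟨(i, n, k), i.2, rfl⟩)
      | @func m F ts ih =>
        have h := hlist n k m ts ih
        -- Applying a symbol has only one premise, the argument list; it is used twice because rules
        -- have two premises.
        exact .step h h (.inr ⟨((_, m), (n, k), _, _), ⟨F, rfl⟩, rfl⟩)
    rcases x with ⟨_ | m, ⟨n, k⟩, c, c'⟩
    · rintro ⟨t, rfl, rfl⟩
      exact hterm n k t
    · rintro ⟨ts, rfl, rfl⟩
      exact hlist n k m ts fun i => hterm n k (ts i)
  · intro h
    induction h with
    | base h =>
      rcases h with ⟨⟨i, n, k⟩, hi, rfl⟩ | ⟨⟨n, k⟩, rfl⟩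
      · exact ⟨Term.var (Sum.inr ⟨i, hi⟩), rfl, termCode_liftAt_var ν _⟩
      · exact ⟨Fin.elim0, rfl, rfl⟩
    | step _ _ h ih ih' =>
      rcases h with ⟨⟨⟨m, n, k⟩, ⟨a, a'⟩, ⟨l, l'⟩⟩, h⟩ | ⟨⟨⟨f, m⟩, ⟨n, k⟩, l, l'⟩, ⟨F, hF⟩, h⟩
      · simp only [Prod.mk.injEq] at h
        obtain ⟨rfl, rfl, rfl⟩ := h
        obtain ⟨t, rfl, rfl⟩ := ih
        obtain ⟨ts, rfl, rfl⟩ := ih'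
        refine ⟨Fin.cons t ts, ?_, ?_⟩ <;> simp [List.ofFn_succ]
      · simp only [Prod.mk.injEq] at h
        obtain ⟨rfl, rfl, rfl⟩ := h
        dsimp only at F hF
        subst hF
        obtain ⟨ts, rfl, rfl⟩ := ih'
        exact ⟨Term.func F ts, rfl, rfl⟩

end Codes

theorem primrec_add_one {α : Type*} [Primcodable α] {f : α → ℕ} (hf : Primrec f) :
    Primrec fun a => f a + 1 := Primrec.succ.comp hf

theorem primrec_succ {α : Type*} [Primcodable α] {f : α → ℕ} (hf : Primrec f) :
    Primrec fun a => (f a).succ := Primrec.succ.comp hf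

theorem primrec_fst {α β γ : Type*} [Primcodable α] [Primcodable β] [Primcodable γ]
    {f : α → β × γ} (hf : Primrec f) : Primrec fun a => (f a).1 := Primrec.fst.comp hf

theorem primrec_snd {α β γ : Type*} [Primcodable α] [Primcodable β] [Primcodable γ]
    {f : α → β × γ} (hf : Primrec f) : Primrec fun a => (f a).2 := Primrec.snd.comp hf

section Codes

variable {L : FirstOrder.Language.{u, v}} (ν : Numbering L)

theorem semiDec_termBase : SemiDec TermBase := by
  refine SemiDec.or (SemiDec.image ?_ (Primrec.to_comp ?_)) (semiDec_range (Primrec.to_comp ?_))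
  · exact semiDec_of_primrecPred
      (Primrec.nat_lt.comp Primrec.fst (Primrec.fst.comp Primrec.snd))
  · have a := primrec_fst (Primrec.id (α := ℕ × ℕ × ℕ))
    have b := primrec_snd (Primrec.id (α := ℕ × ℕ × ℕ))
    exact (Primrec.const 0).pair (b.pair ((primrec_natPair (Primrec.const 0) a).pair
      (primrec_natPair (Primrec.const 0) (primrec_shiftVar (primrec_snd b) a))))
  · exact (Primrec.const 1).pair (Primrec.id.pair (Primrec.const (0, 0)))

theorem semiDec_termStep : SemiDec (TermStep ν) := by
  refine SemiDec.or (semiDec_range (Primrec.to_comp ?_)) (SemiDec.image ?_ (Primrec.to_comp ?_))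
  · have a := primrec_fst (Primrec.id (α := (ℕ × ℕ × ℕ) × (ℕ × ℕ) × ℕ × ℕ))
    have b := primrec_snd (Primrec.id (α := (ℕ × ℕ × ℕ) × (ℕ × ℕ) × ℕ × ℕ))
    have m := primrec_add_one (primrec_fst a)
    have k := primrec_snd a
    have c := primrec_fst b
    have l := primrec_snd b
    have e := primrec_succ (primrec_natPair (primrec_fst c) (primrec_fst l))
    have e' := primrec_succ (primrec_natPair (primrec_snd c) (primrec_snd l))
    have h1 := (Primrec.const 0).pair (k.pair c)
    have h2 := m.pair (k.pair l)
    have h3 := (primrec_add_one m).pair (k.pair (e.pair e'))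
    exact h1.pair (h2.pair h3)

  · exact SemiDec.comp (semiDec_of_computablePred ν.fn_computable) Computable.fst
  · have a := primrec_fst (Primrec.id (α := (ℕ × ℕ) × (ℕ × ℕ) × ℕ × ℕ))
    have b := primrec_snd (Primrec.id (α := (ℕ × ℕ) × (ℕ × ℕ) × ℕ × ℕ))
    have f := primrec_fst a
    have m := primrec_add_one (primrec_snd a)
    have c := primrec_snd b
    have e := primrec_natPair (Primrec.const 1) (primrec_natPair f (primrec_fst c))
    have e' := primrec_natPair (Primrec.const 1) (primrec_natPair f (primrec_snd c))
    have h1 := m.pair b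
    have h2 := (Primrec.const 0).pair ((primrec_fst b).pair (e.pair e'))
    exact h1.pair (h1.pair h2)

theorem semiDec_isTermData : SemiDec (IsTermData ν) :=
  (semiDec_termBase.closure (semiDec_termStep ν)).of_iff (isTermData_iff ν)

/-- Triples consisting of a pair of numbers `n`, `k`, the code of a formula in `n` variables, and
the code of its image under `liftAt 2 k`. -/
abbrev FormulaData := (ℕ × ℕ) × ℕ × ℕ

/-- The correct triples for quantifier-free formulas. -/
def IsFormulaData (x : FormulaData) : Prop :=
  ∃ φ : L.BoundedFormula Empty x.1.1, φ.IsQF ∧ formulaCode ν φ = x.2.1 ∧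
    formulaCode ν (φ.liftAt 2 x.1.2) = x.2.2

/-- Atomic formulas and falsum. -/
def FormulaBase (x : FormulaData) : Prop :=
  (∃ p : ℕ × ℕ, ((p, 0, 0) : FormulaData) = x) ∨
  (∃ p : (ℕ × ℕ) × (ℕ × ℕ) × (ℕ × ℕ), (IsTermData ν (0, p.1, p.2.1) ∧ IsTermData ν (0, p.1, p.2.2)) ∧
    ((p.1, Nat.pair 1 (Nat.pair p.2.1.1 p.2.2.1), Nat.pair 1 (Nat.pair p.2.1.2 p.2.2.2)) :
      FormulaData) = x) ∨
  ∃ p : (ℕ × ℕ) × (ℕ × ℕ) × ℕ × ℕ, ((∃ R : L.Relations p.1.2, ν.rel ⟨_, R⟩ = p.1.1) ∧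
    IsTermData ν (p.1.2 + 1, p.2)) ∧ ((p.2.1, Nat.pair 2 (Nat.pair p.1.1 p.2.2.1),
      Nat.pair 2 (Nat.pair p.1.1 p.2.2.2)) : FormulaData) = x

/-- Implications. -/
def FormulaStep (x : FormulaData × FormulaData × FormulaData) : Prop :=
  ∃ p : (ℕ × ℕ) × (ℕ × ℕ) × (ℕ × ℕ), (((p.1, p.2.1), (p.1, p.2.2),
    (p.1, Nat.pair 3 (Nat.pair p.2.1.1 p.2.2.1), Nat.pair 3 (Nat.pair p.2.1.2 p.2.2.2))) :
      FormulaData × FormulaData × FormulaData) = x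

theorem isFormulaData_iff (x : FormulaData) :
    IsFormulaData ν x ↔ Closure (FormulaBase ν) FormulaStep x := by
  constructor
  · obtain ⟨⟨n, k⟩, c, c'⟩ := x
    rintro ⟨φ, hφ, h1, h2⟩
    dsimp only at φ hφ h1 h2
    subst h1 h2
    induction hφ with
    | falsum => exact .base (.inl ⟨(n, k), rfl⟩)
    | of_isAtomic h =>
      cases h with
      | equal s t => exact .base (.inr (.inl ⟨((n, k), (_, _), (_, _)),
          ⟨⟨s, rfl, rfl⟩, ⟨t, rfl, rfl⟩⟩, rfl⟩))
      | @rel m R ts => exact .base (.inr (.inr ⟨((_, m), (n, k), _, _),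
          ⟨⟨R, rfl⟩, ⟨ts, rfl, rfl⟩⟩, rfl⟩))
    | imp _ _ ih ih' => exact .step ih ih' ⟨((n, k), (_, _), (_, _)), rfl⟩
  · intro h
    induction h with
    | base h =>
      rcases h with ⟨⟨n, k⟩, rfl⟩ | ⟨⟨⟨n, k⟩, ⟨a, a'⟩, ⟨b, b'⟩⟩, ⟨⟨s, h1, h2⟩, ⟨t, h3, h4⟩⟩, rfl⟩ |
        ⟨⟨⟨r, m⟩, ⟨n, k⟩, l, l'⟩, ⟨⟨R, hR⟩, ⟨ts, h1, h2⟩⟩, rfl⟩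
      · exact ⟨BoundedFormula.falsum, .falsum, rfl, rfl⟩
      · subst h1
        subst h2
        subst h3
        subst h4
        exact ⟨BoundedFormula.equal s t, .of_isAtomic (.equal s t), rfl, rfl⟩
      · exact ⟨BoundedFormula.rel R ts, .of_isAtomic (.rel R ts), by rw [← hR, ← h1]; rfl,
          by rw [← hR, ← h2]; rfl⟩
    | step _ _ h ih ih' =>
      obtain ⟨⟨⟨n, k⟩, ⟨a, a'⟩, ⟨b, b'⟩⟩, h⟩ := h
      simp only [Prod.mk.injEq] at h
      obtain ⟨rfl, rfl, rfl⟩ := h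
      obtain ⟨φ, hφ, h1, h2⟩ := ih
      obtain ⟨ψ, hψ, h3, h4⟩ := ih'
      dsimp only at φ ψ h1 h2 h3 h4
      exact ⟨φ.imp ψ, hφ.imp hψ, by rw [← h1, ← h3]; rfl, by rw [← h2, ← h4]; rfl⟩

theorem semiDec_formulaBase : SemiDec (FormulaBase ν) := by
  refine SemiDec.or (semiDec_range (Primrec.to_comp ?_)) (SemiDec.or
    (SemiDec.image (SemiDec.and ?_ ?_) (Primrec.to_comp ?_))
    (SemiDec.image (SemiDec.and ?_ ?_) (Primrec.to_comp ?_)))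
  · exact Primrec.id.pair (Primrec.const (0, 0))
  · exact (semiDec_isTermData ν).comp ((Computable.const 0).pair (Computable.fst.pair
      (Computable.fst.comp Computable.snd)))
  · exact (semiDec_isTermData ν).comp ((Computable.const 0).pair (Computable.fst.pair
      (Computable.snd.comp Computable.snd)))
  · have a := primrec_fst (Primrec.id (α := (ℕ × ℕ) × (ℕ × ℕ) × ℕ × ℕ))
    have b := primrec_snd (Primrec.id (α := (ℕ × ℕ) × (ℕ × ℕ) × ℕ × ℕ))
    have c := primrec_fst b
    have d := primrec_snd b
    have e := primrec_natPair (Primrec.const 1)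
      (primrec_natPair (primrec_fst c) (primrec_fst d))
    have e' := primrec_natPair (Primrec.const 1)
      (primrec_natPair (primrec_snd c) (primrec_snd d))
    exact a.pair (e.pair e')

  · exact SemiDec.comp (semiDec_of_computablePred ν.rel_computable) Computable.fst
  · exact (semiDec_isTermData ν).comp ((Computable.succ.comp
      (Computable.snd.comp Computable.fst)).pair Computable.snd)
  · have a := primrec_fst (Primrec.id (α := (ℕ × ℕ) × (ℕ × ℕ) × ℕ × ℕ))
    have b := primrec_snd (Primrec.id (α := (ℕ × ℕ) × (ℕ × ℕ) × ℕ × ℕ))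
    have f := primrec_fst a
    have c := primrec_snd b
    have e := primrec_natPair (Primrec.const 2) (primrec_natPair f (primrec_fst c))
    have e' := primrec_natPair (Primrec.const 2) (primrec_natPair f (primrec_snd c))
    exact (primrec_fst b).pair (e.pair e')

theorem semiDec_formulaStep : SemiDec FormulaStep := by
  refine semiDec_range (Primrec.to_comp ?_)
  have a := primrec_fst (Primrec.id (α := (ℕ × ℕ) × (ℕ × ℕ) × ℕ × ℕ))
  have b := primrec_snd (Primrec.id (α := (ℕ × ℕ) × (ℕ × ℕ) × ℕ × ℕ))
  have c := primrec_fst b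
  have d := primrec_snd b
  have e := primrec_natPair (Primrec.const 3)
    (primrec_natPair (primrec_fst c) (primrec_fst d))
  have e' := primrec_natPair (Primrec.const 3)
    (primrec_natPair (primrec_snd c) (primrec_snd d))
  have h1 := a.pair c
  have h2 := a.pair d
  have h3 := a.pair (e.pair e')
  exact h1.pair (h2.pair h3)

theorem semiDec_isFormulaData : SemiDec (IsFormulaData ν) :=
  ((semiDec_formulaBase ν).closure semiDec_formulaStep).of_iff (isFormulaData_iff ν)

end Codes

/-! ### Codes of compound formulas -/

/-- The code of a negation. -/
def notCode (c : ℕ) : ℕ := Nat.pair 3 (Nat.pair c (Nat.pair 0 0))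

/-- The code of an existential quantification. -/
def exCode (c : ℕ) : ℕ := notCode (Nat.pair 4 (notCode c))

/-- The code of a conjunction. -/
def andCode (c d : ℕ) : ℕ := notCode (Nat.pair 3 (Nat.pair c (notCode d)))

/-- The code of a universal closure. -/
def allsCode (n c : ℕ) : ℕ := (Nat.pair 4)^[n] c

/-- The code of an atomic formula expressing a binary relation between two variables. -/
def relCode (r i j : ℕ) : ℕ :=
  Nat.pair 2 (Nat.pair r (Encodable.encode [Nat.pair 0 i, Nat.pair 0 j]))

section Primrec

variable {α : Type*} [Primcodable α] {f g h : α → ℕ}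

theorem primrec_notCode (hf : Primrec f) : Primrec fun a => notCode (f a) :=
  primrec_natPair (Primrec.const 3) (primrec_natPair hf (Primrec.const _))

theorem primrec_exCode (hf : Primrec f) : Primrec fun a => exCode (f a) :=
  primrec_notCode (primrec_natPair (Primrec.const 4) (primrec_notCode hf))

theorem primrec_andCode (hf : Primrec f) (hg : Primrec g) : Primrec fun a => andCode (f a) (g a) :=
  primrec_notCode (primrec_natPair (Primrec.const 3) (primrec_natPair hf (primrec_notCode hg)))

theorem primrec_allsCode (hf : Primrec f) (hg : Primrec g) :
    Primrec fun a => allsCode (f a) (g a) :=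
  Primrec.nat_iterate hf hg (primrec_natPair (Primrec.const 4) Primrec.snd)

theorem primrec_relCode (hf : Primrec f) (hg : Primrec g) (hh : Primrec h) :
    Primrec fun a => relCode (f a) (g a) (h a) :=
  primrec_natPair (Primrec.const 2) (primrec_natPair hf (Primrec.encode.comp
    (primrec_cons (primrec_natPair (Primrec.const 0) hg)
      (primrec_cons (primrec_natPair (Primrec.const 0) hh) (Primrec.const [])))))

end Primrec

/-! ### Density axioms relative to a theory with quantifier elimination -/

section Density

variable {L : FirstOrder.Language.{u, v}} (ν : Numbering L)

theorem formulaCode_ex {n : ℕ} (φ : L.BoundedFormula Empty (n + 1)) :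
    formulaCode ν (∃' φ) = exCode (formulaCode ν φ) := rfl

theorem formulaCode_inf {n : ℕ} (φ ψ : L.BoundedFormula Empty n) :
    formulaCode ν (φ ⊓ ψ) = andCode (formulaCode ν φ) (formulaCode ν ψ) := rfl

theorem formulaCode_alls {n : ℕ} (φ : L.BoundedFormula Empty n) :
    formulaCode ν φ.alls = allsCode n (formulaCode ν φ) := by
  induction n with
  | zero => rfl
  | succ n ih => exact ih φ.all

variable (ι : Log →ᴸ L)

/-- The formula `x i < x j`. -/
def ltVar {n : ℕ} (i j : Fin n) : L.BoundedFormula Empty n :=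
  Relations.boundedFormula₂ (ι.onRelation (n := 2) LtRel.lt) (&i) (&j)

/-- The code of the symbol `<`. -/
def ltSymbolCode : ℕ := ν.rel ⟨2, ι.onRelation (n := 2) LtRel.lt⟩

theorem formulaCode_ltVar {n : ℕ} (i j : Fin n) :
    formulaCode ν (ltVar ι i j) = relCode (ltSymbolCode ν ι) i j := by
  simp [ltVar, Relations.boundedFormula₂, Relations.boundedFormula, formulaCode, relCode,
    ltSymbolCode, List.ofFn_succ, termCode]

/-- The order relation of the structure `N`. -/
def StructureLT (N : Type w) [L.Structure N] (a b : N) : Prop :=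
  Structure.RelMap (ι.onRelation (n := 2) LtRel.lt) ![a, b]

theorem realize_ltVar {N : Type w} [L.Structure N] {n : ℕ} (i j : Fin n) (e : Empty → N)
    (x : Fin n → N) : (ltVar ι i j).Realize e x ↔ StructureLT ι N (x i) (x j) := by
  rw [ltVar, BoundedFormula.realize_rel₂]
  rfl

/-- There is an open interval all of whose elements satisfy `θ`. -/
def intervalFormula (n : ℕ) (θ : L.BoundedFormula Empty (n + 1)) : L.BoundedFormula Empty n :=
  ∃' ∃' (ltVar ι (⟨n, by omega⟩ : Fin (n + 2)) ⟨n + 1, by omega⟩ ⊓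
    ∀' (ltVar ι (⟨n, by omega⟩ : Fin (n + 3)) ⟨n + 2, by omega⟩ ⟹
      (ltVar ι (⟨n + 2, by omega⟩ : Fin (n + 3)) ⟨n + 1, by omega⟩ ⟹ θ.liftAt 2 n)))

/-- The code of `intervalFormula` in terms of the code of the lifted formula. -/
def intervalCode (r n c : ℕ) : ℕ :=
  exCode (exCode (andCode (relCode r n (n + 1)) (Nat.pair 4 (Nat.pair 3 (Nat.pair
    (relCode r n (n + 2)) (Nat.pair 3 (Nat.pair (relCode r (n + 2) (n + 1)) c)))))))

theorem formulaCode_intervalFormula (n : ℕ) (θ : L.BoundedFormula Empty (n + 1)) :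
    formulaCode ν (intervalFormula ι n θ) =
      intervalCode (ltSymbolCode ν ι) n (formulaCode ν (θ.liftAt 2 n)) := by
  simp only [intervalFormula, formulaCode_ex, formulaCode_inf, formulaCode_ltVar, formulaCode,
    intervalCode]
  rfl

theorem realize_intervalFormula {N : Type w} [L.Structure N] {n : ℕ}
    (θ : L.BoundedFormula Empty (n + 1)) (e : Empty → N) (x : Fin n → N) :
    (intervalFormula ι n θ).Realize e x ↔ ∃ a b, StructureLT ι N a b ∧
      ∀ z, StructureLT ι N a z → StructureLT ι N z b → θ.Realize e (Fin.snoc x z) := by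
  have h0 (a b z : N) : (Fin.snoc (Fin.snoc (Fin.snoc x a) b) z : Fin (n + 3) → N)
      ⟨n, by omega⟩ = a := by
    simp [Fin.snoc]
  have h1 (a b z : N) : (Fin.snoc (Fin.snoc (Fin.snoc x a) b) z : Fin (n + 3) → N)
      ⟨n + 1, by omega⟩ = b := by
    simp [Fin.snoc]
  have h2 (a b z : N) : (Fin.snoc (Fin.snoc (Fin.snoc x a) b) z : Fin (n + 3) → N)
      ⟨n + 2, by omega⟩ = z := by
    simp [Fin.snoc]
  have h3 (a b : N) : (Fin.snoc (Fin.snoc x a) b : Fin (n + 2) → N) ⟨n, by omega⟩ = a := by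
    simp [Fin.snoc]
  have h4 (a b : N) : (Fin.snoc (Fin.snoc x a) b : Fin (n + 2) → N) ⟨n + 1, by omega⟩ = b := by
    simp [Fin.snoc]
  -- In `θ` the last variable has index `n`. The endpoints now occupy `n` and `n + 1`, so lifting
  -- moves it to `n + 2` and leaves the parameters alone.
  have h5 (a b z : N) : ((Fin.snoc (Fin.snoc (Fin.snoc x a) b) z : Fin (n + 1 + 2) → N) ∘
      fun i : Fin (n + 1) => if (i : ℕ) < n then Fin.castAdd 2 i else Fin.addNat i 2) =
        Fin.snoc x z := by
    funext i
    refine Fin.lastCases ?_ (fun i => ?_) i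
    · simp [Fin.snoc]
    · have := i.2
      simp [Fin.snoc, this, Nat.lt_succ_of_lt this, Nat.lt_succ_of_lt (Nat.lt_succ_of_lt this)]
      rfl
  simp only [intervalFormula, BoundedFormula.realize_ex, BoundedFormula.realize_inf,
    BoundedFormula.realize_all, BoundedFormula.realize_imp, realize_ltVar, h0, h1, h2, h3, h4]
  refine exists_congr fun a => exists_congr fun b => and_congr_right fun _ => forall_congr' fun z =>
    imp_congr_right fun _ => imp_congr_right fun _ => ?_
  rw [← h5 a b z]
  exact BoundedFormula.realize_liftAt (Nat.le_succ n)

/-- The hypothesis under which `densitySentence` is an axiom. -/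
def densityHypothesis (n : ℕ) (θ : L.BoundedFormula Empty n) (θ' : L.BoundedFormula Empty (n + 1)) :
    L.Sentence :=
  (θ ⟹ intervalFormula ι n θ').alls

/-- If `θ` holds, then some element satisfies `θ'`. -/
def densitySentence (n : ℕ) (θ : L.BoundedFormula Empty n) (θ' : L.BoundedFormula Empty (n + 1)) :
    L.Sentence :=
  (θ ⟹ ∃' θ').alls

/-- The density axioms relative to `T`. -/
def densityTheory (T : L.Theory) : L.Theory :=
  {σ | ∃ (n : ℕ) (θ : L.BoundedFormula Empty n) (θ' : L.BoundedFormula Empty (n + 1)),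
    θ.IsQF ∧ θ'.IsQF ∧ T ⊨ᵇ densityHypothesis ι n θ θ' ∧ σ = densitySentence n θ θ'}

theorem realize_densityHypothesis {N : Type w} [L.Structure N] {n : ℕ}
    (θ : L.BoundedFormula Empty n) (θ' : L.BoundedFormula Empty (n + 1)) :
    N ⊨ densityHypothesis ι n θ θ' ↔ ∀ x : Fin n → N, θ.Realize default x →
      ∃ a b, StructureLT ι N a b ∧
        ∀ z, StructureLT ι N a z → StructureLT ι N z b → θ'.Realize default (Fin.snoc x z) := by
  rw [Sentence.Realize, Formula.Realize, densityHypothesis]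
  refine BoundedFormula.realize_alls.trans ?_
  simp only [BoundedFormula.realize_imp, realize_intervalFormula]

theorem realize_densitySentence {N : Type w} [L.Structure N] {n : ℕ}
    (θ : L.BoundedFormula Empty n) (θ' : L.BoundedFormula Empty (n + 1)) :
    N ⊨ densitySentence n θ θ' ↔ ∀ x : Fin n → N, θ.Realize default x →
      ∃ z, θ'.Realize default (Fin.snoc x z) := by
  rw [Sentence.Realize, Formula.Realize, densitySentence]
  refine BoundedFormula.realize_alls.trans ?_
  simp only [BoundedFormula.realize_imp, BoundedFormula.realize_ex]

/-- Quantifier-free formulas are absolute between `M` and `N`; this carries the density axioms from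
one to the other. -/
theorem realize_substructure {N : Type w} [L.Structure N] (M : L.Substructure N) {n : ℕ}
    {θ : L.BoundedFormula Empty n} (hθ : θ.IsQF) (x : Fin n → M) :
    θ.Realize default (fun i => (x i : N)) ↔ θ.Realize default x := by
  rw [← hθ.realize_embedding M.subtype, Subsingleton.elim (M.subtype ∘ default) default]
  rfl

theorem realize_substructure_snoc {N : Type w} [L.Structure N] (M : L.Substructure N) {n : ℕ}
    {θ : L.BoundedFormula Empty (n + 1)} (hθ : θ.IsQF) (x : Fin n → M) (z : M) :
    θ.Realize default (Fin.snoc (fun i => (x i : N)) (z : N)) ↔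
      θ.Realize default (Fin.snoc x z) := by
  rw [← realize_substructure M hθ]
  have h : (Fin.snoc (fun i => (x i : N)) (z : N) : Fin (n + 1) → N) =
      fun i => ((Fin.snoc x z : Fin (n + 1) → M) i : N) := by
    funext i
    refine Fin.lastCases ?_ (fun i => ?_) i <;> simp
  rw [h]

theorem HasQE.exists_isQF {T : L.Theory} (hT : HasQE T) {n : ℕ} (φ : L.BoundedFormula Empty n) :
    ∃ ψ : L.BoundedFormula Empty n, ψ.IsQF ∧ (φ ⇔[T] ψ) := by
  -- Elimination is stated for free variables in `Fin n`, so the indexed variables are made free,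
  -- eliminated, and turned back.
  obtain ⟨ψ, hψ, h⟩ := hT n (φ.toFormula.relabel (Sum.elim Empty.elim id))
  refine ⟨BoundedFormula.relabel Sum.inr ψ, hψ.relabel _, fun N v x => ?_⟩
  have h' := Theory.Iff.realize_iff (M := N) h (v := x)
  rw [Formula.realize_relabel, BoundedFormula.realize_toFormula] at h'
  refine BoundedFormula.realize_iff.2 (Iff.trans ?_ (h'.trans
    (Formula.realize_relabel_sumInr ψ).symm))
  rw [Subsingleton.elim v]
  rfl

/-- The endpoints are definable over `A`, hence so is the interval: it is a projection of the set of
triples (a, b, z) with a < z < b. -/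
theorem exists_formula_interval {N : Type w} [L.Structure N] {A : Set N}
    (hA : dcl L A = Set.univ) (a b : N) :
    ∃ (n : ℕ) (φ : L.BoundedFormula Empty (n + 1)) (x : Fin n → A), ∀ z : N,
      φ.Realize default (Fin.snoc (fun i => (x i : N)) z) ↔
        StructureLT ι N a z ∧ StructureLT ι N z b := by
  have ha : A.Definable₁ L {a} := hA.ge (Set.mem_univ a)
  have hb : A.Definable₁ L {b} := hA.ge (Set.mem_univ b)
  have hlt : ∀ i j : Fin 3, A.Definable L {y : Fin 3 → N | StructureLT ι N (y i) (y j)} := by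
    intro i j
    refine (Set.empty_definable_iff.2 ⟨Relations.formula₂ (ι.onRelation (n := 2) LtRel.lt)
      (Term.var i) (Term.var j), ?_⟩).mono (Set.empty_subset A)
    ext y
    simp [StructureLT, Formula.realize_rel₂]
  have h := ((((ha.preimage_comp (fun _ => (0 : Fin 3))).inter
    (hb.preimage_comp (fun _ => (1 : Fin 3)))).inter
      ((hlt 0 2).inter (hlt 2 1))).image_comp (fun _ : Fin 1 => (2 : Fin 3)))
  -- Only finitely many parameters occur; enumerating them turns constants into variables.
  obtain ⟨A0, hA0, h⟩ := Set.definable_iff_finitely_definable.1 h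
  obtain ⟨φ, hφ⟩ := Set.definable_iff_exists_formula_sum.1 h
  have e := Fintype.equivFin (A0 : Set N)
  refine ⟨Fintype.card (A0 : Set N), BoundedFormula.relabel (k := 0)
    (Sum.inr : Fin (_ + 1) → Empty ⊕ Fin (_ + 1))
    (φ.relabel (Sum.elim (fun c => (e c).castSucc) fun _ => Fin.last _)), fun i => ⟨e.symm i, hA0 (e.symm i).2⟩, fun z => ?_⟩
  have h1 := Set.ext_iff.1 hφ (fun _ => z)
  have h2 : (fun _ => z) ∈ (fun g : Fin 3 → N => g ∘ fun _ : Fin 1 => (2 : Fin 3)) ''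
      ((((fun g : Fin 3 → N => g ∘ fun _ : Fin 1 => (0 : Fin 3)) ⁻¹' {x | x 0 ∈ ({a} : Set N)}) ∩
        ((fun g : Fin 3 → N => g ∘ fun _ : Fin 1 => (1 : Fin 3)) ⁻¹' {x | x 0 ∈ ({b} : Set N)})) ∩
        ({y | StructureLT ι N (y 0) (y 2)} ∩ {y | StructureLT ι N (y 2) (y 1)})) ↔
      StructureLT ι N a z ∧ StructureLT ι N z b := by
    constructor
    · rintro ⟨y, ⟨⟨h1, h2⟩, h3, h4⟩, h5⟩
      have h1 : y 0 = a := h1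
      have h2 : y 1 = b := h2
      have h5 : y 2 = z := congrFun h5 0
      subst h1 h2 h5
      exact ⟨h3, h4⟩
    · rintro ⟨h3, h4⟩
      refine ⟨![a, b, z], ⟨⟨rfl, rfl⟩, h3, h4⟩, ?_⟩
      funext i
      rfl
  refine Iff.trans ?_ (h1.symm.trans h2)
  refine (Formula.realize_relabel_sumInr _).trans (Formula.realize_relabel.trans ?_)
  refine iff_of_eq (congrArg _ ?_)
  funext y
  rcases y with c | i <;> simp

/-- The pair (θ, θ') is obtained by eliminating quantifiers twice: in the definition of the
interval, and in the statement that θ' contains an interval around nothing but parameters x. -/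
theorem axiomatisesDensity {T S S' : L.Theory} (hQE : HasQE T)
    (hS : ∀ (M : Type w) [L.Structure M], M ⊨ S' ↔ M ⊨ S ∧ M ⊨ densityTheory ι T) :
    AxiomatisesDensity.{u, v, w} ι T S S' := by
  intro N _ hN M hM
  have hne : Nonempty N := ⟨Structure.funMap (ι.onFunction (n := 0) OgFunc.zero) Fin.elim0⟩
  rw [hS M]
  refine and_congr_right fun _ => ?_
  rw [Theory.model_iff]
  constructor
  · intro h a b hab
    obtain ⟨n, φ, x, hφ⟩ := exists_formula_interval ι hM a b
    obtain ⟨θ', hθ', h'⟩ := hQE.exists_isQF φ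
    obtain ⟨θ, hθ, h''⟩ := hQE.exists_isQF (intervalFormula ι n θ')
    have hN' := fun z => (hφ z).symm.trans h'.realize_bd_iff
    -- In every model of `T` the formula θ is equivalent to the existence of the interval, so the
    -- side condition of the axiom is met.
    have hMx := (realize_densitySentence θ θ').1 (h _ ⟨n, θ, θ', hθ, hθ', fun K _ _ => by
      have := (realize_densityHypothesis (N := K) ι θ θ').2 fun y hy =>
        (realize_intervalFormula ι θ' _ y).1 (h''.realize_bd_iff.2 hy)
      rw [Sentence.Realize, Formula.Realize] at this
      convert this, rfl⟩) x
    obtain ⟨z, hz⟩ := hMx ((realize_substructure M hθ x).1 (h''.realize_bd_iff.1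
      ((realize_intervalFormula ι θ' _ _).2 ⟨a, b, hab, fun z h1 h2 => (hN' z).1 ⟨h1, h2⟩⟩)))
    exact ⟨z, z.2, (hN' z).2 ((realize_substructure_snoc M hθ' x z).2 hz)⟩
  · rintro h _ ⟨n, θ, θ', hθ, hθ', hT, rfl⟩
    refine (realize_densitySentence θ θ').2 fun x hx => ?_
    obtain ⟨a, b, hab, h'⟩ := (realize_densityHypothesis ι θ θ').1 (hT.realize_sentence N) _
      ((realize_substructure M hθ x).2 hx)
    obtain ⟨z, hz, h1, h2⟩ := h a b hab
    exact ⟨⟨z, hz⟩, (realize_substructure_snoc M hθ' x ⟨z, hz⟩).1 (h' z h1 h2)⟩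

theorem primrec_intervalCode {α : Type*} [Primcodable α] (r : ℕ) {f g : α → ℕ} (hf : Primrec f)
    (hg : Primrec g) : Primrec fun a => intervalCode r (f a) (g a) := by
  have hr := Primrec.const (α := α) r
  have h1 := primrec_add_one hf
  have h2 := primrec_add_one h1
  exact primrec_exCode (primrec_exCode (primrec_andCode (primrec_relCode hr hf h1)
    (primrec_natPair (Primrec.const 4) (primrec_natPair (Primrec.const 3) (primrec_natPair
      (primrec_relCode hr hf h2) (primrec_natPair (Primrec.const 3)
        (primrec_natPair (primrec_relCode hr h2 h1) hg)))))))

/-- An axiom is found by guessing the codes of θ and θ' together with their lifted codes and a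
refutation certifying the side condition. The lifted code of θ is not needed; that of θ' enters the
interval formula. -/
theorem semiDec_densityTheory {T : L.Theory} (hT : IsRecursive ν T) :
    SemiDec fun c => ∃ σ ∈ densityTheory ι T, formulaCode ν σ = c := by
  obtain ⟨p, hp, h⟩ := hT.semiDec_models
  have a := primrec_fst (Primrec.id (α := ℕ × (ℕ × ℕ) × ℕ × ℕ))
  have b := primrec_snd (Primrec.id (α := ℕ × (ℕ × ℕ) × ℕ × ℕ))
  have c := primrec_fst b
  have d := primrec_snd b
  have h1 := (semiDec_isFormulaData ν).comp ((a.pair a).pair c).to_comp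
  have h2 := (semiDec_isFormulaData ν).comp (((primrec_add_one a).pair a).pair d).to_comp
  have h3 := hp.comp (primrec_allsCode a (primrec_natPair (Primrec.const 3) (primrec_natPair
    (primrec_fst c) (primrec_intervalCode (ltSymbolCode ν ι) a (primrec_snd d))))).to_comp
  have h4 := primrec_allsCode a (primrec_natPair (Primrec.const 3) (primrec_natPair
    (primrec_fst c) (primrec_exCode (primrec_fst d))))
  refine (SemiDec.image (h1.and (h2.and h3)) h4.to_comp).of_iff fun c => ?_
  have key : ∀ (n : ℕ) (θ : L.BoundedFormula Empty n) (θ' : L.BoundedFormula Empty (n + 1)),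
      formulaCode ν (densityHypothesis ι n θ θ') = allsCode n (Nat.pair 3 (Nat.pair
        (formulaCode ν θ) (intervalCode (ltSymbolCode ν ι) n (formulaCode ν (θ'.liftAt 2 n))))) ∧
      formulaCode ν (densitySentence n θ θ') = allsCode n (Nat.pair 3 (Nat.pair
        (formulaCode ν θ) (exCode (formulaCode ν θ')))) := by
    intro n θ θ'
    exact ⟨by rw [densityHypothesis, formulaCode_alls, formulaCode, formulaCode_intervalFormula],
      by rw [densitySentence, formulaCode_alls, formulaCode, formulaCode_ex]⟩
  constructor
  · rintro ⟨_, ⟨n, θ, θ', hθ, hθ', hT', rfl⟩, rfl⟩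
    refine ⟨(n, (formulaCode ν θ, formulaCode ν (θ.liftAt 2 n)),
      (formulaCode ν θ', formulaCode ν (θ'.liftAt 2 n))), ⟨⟨θ, hθ, rfl, rfl⟩, ⟨θ', hθ', rfl, rfl⟩,
        ?_⟩, ((key n θ θ').2).symm⟩
    have := (h _).1 hT'
    rwa [(key n θ θ').1] at this
  · rintro ⟨⟨n, ⟨c, c'⟩, ⟨d, d'⟩⟩, ⟨⟨θ, hθ, h1, h2⟩, ⟨θ', hθ', h3, h4⟩, h5⟩, rfl⟩
    refine ⟨_, ⟨n, θ, θ', hθ, hθ', (h _).2 ?_, rfl⟩, ?_⟩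
    · rw [(key n θ θ').1]
      dsimp only [id] at h1 h4 h5
      rw [h1]
      erw [h4]
      exact h5
    · rw [(key n θ θ').2]
      dsimp only [id] at h1 h3
      rw [h1]
      erw [h3]
      rfl

theorem exists_axiomatisesDensity {T : L.Theory} (S : L.Theory) (hQE : HasQE T) :
    ∃ S' : L.Theory, S ⊆ S' ∧ AxiomatisesDensity.{u, v, w} ι T S S' :=
  ⟨S ∪ densityTheory ι T, Set.subset_union_left, axiomatisesDensity ι hQE fun M _ => by
    simp only [Theory.model_iff, Set.mem_union, or_imp, forall_and]⟩

theorem exists_isRecursive_axiomatisesDensity {T S : L.Theory} (hQE : HasQE T)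
    (hT : IsRecursive ν T) (hS : IsRecursive ν S) :
    ∃ S' : L.Theory, S ⊆ S' ∧ IsRecursive ν S' ∧ AxiomatisesDensity.{u, v, w} ι T S S' := by
  obtain ⟨S₁, h₁, h₂⟩ := exists_isRecursive.{u, v, w} ν (semiDec_densityTheory ν ι hT)
  refine ⟨S ∪ S₁, Set.subset_union_left, hS.union h₁, axiomatisesDensity ι hQE fun M _ => ?_⟩
  rw [← h₂ M]
  simp only [Theory.model_iff, Set.mem_union, or_imp, forall_and]

end Density

/-! ### Complete ordered fields -/

section Complete

open Filter Topology Uniformity Polynomial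

variable {F : Type w} [Field F] [LinearOrder F] [IsStrictOrderedRing F]

/-- Lagrange interpolation at d + 1 nodes writes the leading coefficient 1 as the sum of p(x) / ∏ (x
− y). Each denominator is at least ε^d in absolute value, so 1 ≤ (d + 1) δ / ε^d. -/
theorem pow_le_of_separated {p : F[X]} (hp : p.Monic) {t : Finset F}
    (ht : t.card = p.natDegree + 1) {ε δ : F} (hε : 0 < ε)
    (hsep : ∀ x ∈ t, ∀ y ∈ t, x ≠ y → ε ≤ |x - y|) (hδ : ∀ x ∈ t, |p.eval x| ≤ δ) :
    ε ^ p.natDegree ≤ (p.natDegree + 1) * δ := by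
  have h := Lagrange.leadingCoeff_eq_sum (s := t) (v := id) (fun _ _ _ _ h => h) (P := p)
    (by rw [ht, Polynomial.degree_eq_natDegree hp.ne_zero]; rfl)
  have hpos : 0 < ε ^ p.natDegree := pow_pos hε _
  have h1 : ∀ x ∈ t, |p.eval x / ∏ y ∈ t.erase x, (x - y)| ≤ δ / ε ^ p.natDegree := by
    intro x hx
    rw [abs_div, Finset.abs_prod]
    have h2 : ε ^ p.natDegree ≤ ∏ y ∈ t.erase x, |x - y| := by
      have h3 : (t.erase x).card = p.natDegree := by
        rw [Finset.card_erase_of_mem hx, ht]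
        rfl
      rw [← h3, ← Finset.prod_const]
      exact Finset.prod_le_prod (fun _ _ => hε.le) fun y hy =>
        hsep x hx y (Finset.mem_of_mem_erase hy) (Finset.ne_of_mem_erase hy).symm
    exact div_le_div₀ ((abs_nonneg _).trans (hδ x hx)) (hδ x hx) hpos h2
  have h4 : (1 : F) ≤ (p.natDegree + 1) * (δ / ε ^ p.natDegree) := by
    calc (1 : F) = |p.leadingCoeff| := by rw [hp.leadingCoeff, abs_one]
      _ ≤ ∑ x ∈ t, |p.eval x / ∏ y ∈ t.erase x, (x - y)| := by
        rw [h]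
        exact Finset.abs_sum_le_sum_abs _ _
      _ ≤ ∑ _x ∈ t, δ / ε ^ p.natDegree := Finset.sum_le_sum h1
      _ = _ := by rw [Finset.sum_const, ht, nsmul_eq_mul]; push_cast; rfl
  rwa [mul_div_assoc', one_le_div hpos] at h4

variable [UniformSpace F] [IsUniformAddGroup F] [OrderTopology F]

theorem hasBasis_uniformity_abs :
    (𝓤 F).HasBasis (fun e : F => 0 < e) fun e => {p | |p.2 - p.1| < e} := by
  rw [uniformity_eq_comap_nhds_zero F]
  have h := (nhds_basis_abs_sub_lt (0 : F)).comap fun x : F × F => x.2 - x.1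
  simp only [sub_zero] at h
  exact h

theorem cauchy_iff_abs {l : Filter F} :
    Cauchy l ↔ l.NeBot ∧ ∀ e : F, 0 < e → ∃ s ∈ l, ∀ x ∈ s, ∀ y ∈ s, |x - y| < e := by
  rw [hasBasis_uniformity_abs.cauchy_iff]
  refine and_congr_right fun _ => forall₂_congr fun e _ => exists_congr fun s =>
    and_congr_right fun _ => ?_
  exact ⟨fun h x hx y hy => h y hy x hx, fun h x hx y hy => h y hy x hx⟩

/-- An ultrafilter along which `p` tends to 0 is used because the uniformity need not be countably
generated. It is Cauchy, and its limit is a root by continuity. -/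
theorem exists_root_of_approx [CompleteSpace F] {p : F[X]} (hp : p.Monic)
    (h : ∀ e : F, 0 < e → ∃ y, |p.eval y| < e) : ∃ y, p.IsRoot y := by
  have hne : (comap (fun y => p.eval y) (𝓝 0)).NeBot := by
    refine ((nhds_basis_abs_sub_lt (0 : F)).comap _).neBot_iff.2 fun {e} he => ?_
    obtain ⟨y, hy⟩ := h e he
    exact ⟨y, by simpa using hy⟩
  obtain ⟨U, hU⟩ := Ultrafilter.exists_le (comap (fun y => p.eval y) (𝓝 (0 : F)))
  have hmem : ∀ e : F, 0 < e → {y | |p.eval y| < e} ∈ U := fun e he => hU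
    (mem_comap.2 ⟨{z | |z| < e}, by simpa using (nhds_basis_abs_sub_lt (0 : F)).mem_of_mem he,
      fun _ h => h⟩)
  have hcauchy : Cauchy (U : Filter F) := by
    rw [cauchy_iff_abs]
    refine ⟨U.neBot, fun e he => ?_⟩
    by_cases hb : ∃ x, {y | |y - x| < e / 2} ∈ U
    · obtain ⟨x, hx⟩ := hb
      refine ⟨_, hx, fun y hy z hz => ?_⟩
      have h1 : |y - x| < e / 2 := hy
      have h2 : |z - x| < e / 2 := hz
      have h3 := abs_sub_le y x z
      rw [abs_sub_comm x z] at h3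
      linarith
    · push Not at hb
      exfalso
      set d := p.natDegree
      -- With this δ one has (d + 1) δ < (d + 2) δ = (e / 2)^d, contradicting the interpolation
      -- bound for d + 1 separated points.
      set δ := (e / 2) ^ d / (d + 2) with hδ
      have hd : (0 : F) < d + 2 := by positivity
      have hδ0 : 0 < δ := div_pos (pow_pos (half_pos he) _) hd
      have key : ∀ n : ℕ, ∃ t : Finset F, t.card = n ∧ (∀ x ∈ t, |p.eval x| < δ) ∧
          ∀ x ∈ t, ∀ y ∈ t, x ≠ y → e / 2 ≤ |x - y| := by
        intro n
        induction n with
        | zero => exact ⟨∅, rfl, by simp, by simp⟩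
        | succ n ih =>
          obtain ⟨t, rfl, ht, ht'⟩ := ih
          -- No ball of radius e / 2 belongs to the ultrafilter, so the complements of finitely many
          -- do; a further point can be picked away from all earlier ones.
          have h1 : (⋂ x ∈ t, {y | |y - x| < e / 2}ᶜ) ∈ (U : Filter F) :=
            (Filter.biInter_finset_mem t).2 fun x _ => Ultrafilter.compl_mem_iff_notMem.2 (hb x)
          obtain ⟨z, hz, hz'⟩ := U.nonempty_of_mem (inter_mem (hmem δ hδ0) h1)
          have hz1 : ∀ x ∈ t, e / 2 ≤ |z - x| := fun x hx => by
            simpa using Set.mem_iInter₂.1 hz' x hx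
          have hzt : z ∉ t := fun h => by
            have := hz1 z h
            rw [sub_self, abs_zero] at this
            linarith
          classical
          refine ⟨insert z t, Finset.card_insert_of_notMem hzt, ?_, ?_⟩
          · intro x hx
            rcases Finset.mem_insert.1 hx with rfl | hx
            exacts [hz, ht x hx]
          · intro x hx y hy hxy
            rcases Finset.mem_insert.1 hx with hx' | hx' <;>
              rcases Finset.mem_insert.1 hy with hy' | hy'
            · exact absurd (hx'.trans hy'.symm) hxy
            · exact hx' ▸ hz1 y hy'
            · rw [hy', abs_sub_comm]
              exact hz1 x hx'
            · exact ht' x hx' y hy' hxy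
      obtain ⟨t, ht, h1, h2⟩ := key (d + 1)
      have h3 := pow_le_of_separated hp ht (half_pos he) h2 fun x hx => (h1 x hx).le
      have h4 : (d + 2) * δ = (e / 2) ^ d := by
        rw [hδ]
        field_simp
      have h5 : (e / 2) ^ d ≤ (d + 1) * δ := h3
      linarith
  obtain ⟨y, hy⟩ := CompleteSpace.complete hcauchy
  refine ⟨y, ?_⟩
  have h1 : Tendsto (fun y => p.eval y) U (𝓝 (p.eval y)) :=
    (p.continuous.tendsto y).mono_left hy
  have h2 : Tendsto (fun y => p.eval y) U (𝓝 0) := tendsto_iff_comap.2 hU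
  exact tendsto_nhds_unique h1 h2

end Complete

/-! ### The completion of an ordered field -/

section Completion

open Filter Topology Uniformity UniformSpace

variable (K : Type w) [Field K] [LinearOrder K] [IsStrictOrderedRing K] [UniformSpace K]
  [IsUniformAddGroup K] [OrderTopology K]

theorem completableTopField : CompletableTopField K where
  nice l hl h0 := by
    have hd : Disjoint (𝓝 (0 : K)) l := disjoint_iff.2 h0
    obtain ⟨e, he, hd⟩ := ((nhds_basis_abs_sub_lt (0 : K)).disjoint_iff_left).1 hd
    rw [cauchy_iff_abs] at hl ⊢
    obtain ⟨hne, hl⟩ := hl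
    refine ⟨hne.map _, fun c hc => ?_⟩
    -- Away from 0, where |x|, |y| ≥ e, the difference of inverses is |y − x| / (|x| |y|), which is
    -- then less than c.
    obtain ⟨s, hs, h⟩ := hl (c * (e * e)) (by positivity)
    refine ⟨(fun x => x⁻¹) '' (s ∩ {b | |b - 0| < e}ᶜ), image_mem_map (inter_mem hs hd), ?_⟩
    rintro _ ⟨x, ⟨hx, hx'⟩, rfl⟩ _ ⟨y, ⟨hy, hy'⟩, rfl⟩
    have hx1 : e ≤ |x| := by simpa using hx'
    have hy1 : e ≤ |y| := by simpa using hy'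
    have hx0 : x ≠ 0 := abs_pos.1 (he.trans_le hx1)
    have hy0 : y ≠ 0 := abs_pos.1 (he.trans_le hy1)
    dsimp only
    rw [inv_sub_inv hx0 hy0, abs_div, abs_mul, div_lt_iff₀ (by positivity)]
    calc |y - x| < c * (e * e) := h y hy x hx
      _ ≤ c * (|x| * |y|) := by gcongr

instance : CompletableTopField K := completableTopField K

end Completion

section Completion

open Filter Topology Uniformity UniformSpace

variable (K : Type w) [Field K] [LinearOrder K] [IsStrictOrderedRing K] [UniformSpace K]
  [IsUniformAddGroup K] [OrderTopology K]

/-- The closure of the set of nonnegative elements of `K` in the completion. -/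
def completionNonneg : Set (Completion K) := closure ((↑) '' {k : K | 0 ≤ k})

variable {K}

theorem coe_mem_completionNonneg {K : Type w} [Field K] [LinearOrder K] [UniformSpace K]
    {k : K} (hk : 0 ≤ k) : (k : Completion K) ∈ completionNonneg K :=
  subset_closure ⟨k, hk, rfl⟩

theorem uniformContinuous_abs_of_order : UniformContinuous fun k : K => |k| := by
  refine (hasBasis_uniformity_abs.uniformContinuous_iff hasBasis_uniformity_abs).2
    fun e he => ⟨e, he, fun x y h => ?_⟩
  exact (abs_abs_sub_abs_le _ _).trans_lt h

/-- The absolute value extends continuously to the completion and fixes the cone. Its value at x is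
then both x and −x, so 2x = 0. -/
theorem eq_zero_of_mem_of_neg_mem_completionNonneg {x : Completion K}
    (hx : x ∈ completionNonneg K) (hx' : -x ∈ completionNonneg K) : x = 0 := by
  have hc : Continuous (Completion.map fun k : K => |k|) := Completion.continuous_map
  have hcoe : ∀ k : K, Completion.map (fun k : K => |k|) (k : Completion K) = (|k| : K) :=
    fun k => Completion.map_coe uniformContinuous_abs_of_order k
  have h1 : ∀ y ∈ completionNonneg K, Completion.map (fun k : K => |k|) y = y := by
    refine closure_minimal ?_ (isClosed_eq hc continuous_id)
    rintro _ ⟨k, hk, rfl⟩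
    exact (hcoe k).trans (by rw [abs_of_nonneg hk])
  have h2 : ∀ y ∈ completionNonneg K, Completion.map (fun k : K => |k|) (-y) = y := by
    refine closure_minimal ?_ (isClosed_eq (hc.comp continuous_neg) continuous_id)
    rintro _ ⟨k, hk, rfl⟩
    have : Completion.map (fun k : K => |k|) (-(k : Completion K)) = (k : Completion K) := by
      rw [← Completion.coe_neg, hcoe, abs_neg, abs_of_nonneg hk]
    exact this
  have h3 : x = -x := by
    have := h2 _ hx'
    rw [neg_neg, h1 _ hx] at this
    exact this
  have h4 : (2 : Completion K) * x = 0 := by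
    rw [two_mul]
    nth_rewrite 2 [h3]
    exact add_neg_cancel x
  have h5 : (2 : Completion K) ≠ 0 := by
    have h6 : ((2 : K) : Completion K) ≠ ((0 : K) : Completion K) := fun h =>
      two_ne_zero (Completion.coe_injective K h)
    have h7 : ((2 : K) : Completion K) = 2 := map_ofNat Completion.coeRingHom 2
    rwa [h7] at h6
  exact (mul_eq_zero.1 h4).resolve_left h5

variable (K) in
/-- The cone of nonnegative elements of the completion. -/
def completionCone : RingCone (Completion K) where
  carrier := completionNonneg K
  zero_mem' := coe_mem_completionNonneg le_rfl
  one_mem' := coe_mem_completionNonneg zero_le_one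
  add_mem' {x y} hx hy := map_mem_closure₂ continuous_add hx hy (by
    rintro _ ⟨a, ha, rfl⟩ _ ⟨b, hb, rfl⟩
    exact ⟨a + b, add_nonneg ha hb, Completion.coe_add a b⟩)
  mul_mem' {x y} hx hy := map_mem_closure₂ continuous_mul hx hy (by
    rintro _ ⟨a, ha, rfl⟩ _ ⟨b, hb, rfl⟩
    exact ⟨a * b, mul_nonneg ha hb, Completion.coe_mul a b⟩)
  eq_zero_of_mem_of_neg_mem' := eq_zero_of_mem_of_neg_mem_completionNonneg

instance : HasMemOrNegMem (completionCone K) where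
  mem_or_neg_mem x := by
    have h : ∀ y : Completion K, y ∈ completionNonneg K ∪ Neg.neg ⁻¹' completionNonneg K := by
      intro y
      refine Completion.denseRange_coe.induction_on y
        (isClosed_closure.union (isClosed_closure.preimage continuous_neg)) fun k => ?_
      rcases le_total 0 k with hk | hk
      · exact .inl (coe_mem_completionNonneg hk)
      · refine .inr ?_
        rw [Set.mem_preimage, ← Completion.coe_neg]
        exact coe_mem_completionNonneg (neg_nonneg.2 hk)
    exact h x

open Classical in
noncomputable instance : LinearOrder (Completion K) := LinearOrder.mkOfAddGroupCone (completionCone K)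

instance : IsStrictOrderedRing (Completion K) :=
  haveI : IsOrderedRing (Completion K) := IsOrderedRing.mkOfCone (completionCone K)
  IsOrderedRing.toIsStrictOrderedRing _

theorem completion_le_iff (x y : Completion K) : x ≤ y ↔ y - x ∈ completionNonneg K := Iff.rfl

theorem completion_coe_strictMono : StrictMono ((↑) : K → Completion K) := by
  refine Monotone.strictMono_of_injective (fun a b h => ?_) (Completion.coe_injective K)
  rw [completion_le_iff, ← Completion.coe_sub]
  exact coe_mem_completionNonneg (sub_nonneg.2 h)

theorem isOpen_completion_Ioo (a b : Completion K) : IsOpen {x | a < x ∧ x < b} := by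
  have h1 : IsClosed {x : Completion K | x ≤ a} :=
    isClosed_closure.preimage (continuous_const.sub continuous_id)
  have h2 : IsClosed {x : Completion K | b ≤ x} :=
    isClosed_closure.preimage (continuous_id.sub continuous_const)
  have h := (h1.isOpen_compl.inter h2.isOpen_compl)
  convert! h using 1
  ext x
  exact (and_congr not_le not_le).symm

theorem exists_coe_between {a b : Completion K} (h : a < b) :
    ∃ k : K, a < (k : Completion K) ∧ (k : Completion K) < b := by
  obtain ⟨c, hc, hc'⟩ := exists_between h
  obtain ⟨x, hx, k, rfl⟩ := Completion.denseRange_coe.inter_open_nonempty _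
    (isOpen_completion_Ioo a b) ⟨c, hc, hc'⟩
  exact ⟨k, hx⟩

/-- Comparison of the completion topology with the order at 0. A closed neighbourhood `t` contains
all points of `K` in some interval (−e, e); these are dense in the corresponding interval of the
completion, which therefore lies in `t`. -/
theorem nhds_zero_completion :
    (𝓝 (0 : Completion K)).HasBasis (fun e : Completion K => 0 < e) fun e => {x | |x| < e} := by
  refine ⟨fun s => ⟨fun hs => ?_, ?_⟩⟩
  · obtain ⟨t, ⟨ht, hcl⟩, hts⟩ := (closed_nhds_basis (0 : Completion K)).mem_iff.1 hs
    have h1 : ((↑) : K → Completion K) ⁻¹' t ∈ 𝓝 (0 : K) :=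
      (Completion.continuous_coe K).continuousAt.preimage_mem_nhds ht
    obtain ⟨e, he, h2⟩ := (nhds_basis_abs_sub_lt (0 : K)).mem_iff.1 h1
    refine ⟨e, completion_coe_strictMono he, fun x hx => hts ?_⟩
    rw [← hcl.closure_eq]
    rw [Set.mem_ofPred_eq, abs_lt] at hx
    have h3 := Completion.denseRange_coe.open_subset_closure_inter
      (isOpen_completion_Ioo (-(e : Completion K)) e) hx
    refine closure_mono ?_ h3
    rintro _ ⟨⟨h4, h5⟩, k, rfl⟩
    refine h2 ?_
    rw [← Completion.coe_neg] at h4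
    rw [Set.mem_ofPred_eq, sub_zero, abs_lt]
    exact ⟨completion_coe_strictMono.lt_iff_lt.1 h4, completion_coe_strictMono.lt_iff_lt.1 h5⟩
  · rintro ⟨e, he, hs⟩
    refine mem_of_superset ((isOpen_completion_Ioo (-e) e).mem_nhds ⟨neg_lt_zero.2 he, he⟩) ?_
    exact fun x hx => hs (abs_lt.2 hx)

instance : OrderTopology (Completion K) := by
  refine orderTopology_of_nhds_abs fun a => ?_
  have h : (𝓝 a).HasBasis (fun e : Completion K => 0 < e) fun e => {x | |a - x| < e} := by
    have h1 := nhds_zero_completion (K := K).comap fun x => a - x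
    rwa [show comap (fun x => a - x) (𝓝 (0 : Completion K)) = 𝓝 a by
      have := (Homeomorph.subLeft a).comap_nhds_eq 0
      simpa using this] at h1
  exact h.eq_biInf

end Completion

/-! ### Approximate roots -/

section Approximate

open Polynomial

/-- Positive elements have approximate square roots, and monic polynomials of odd degree have
approximate roots. -/
structure HasApproximateRoots (K : Type w) [Field K] [LinearOrder K] : Prop where
  sq : ∀ x e : K, 0 < x → 0 < e → ∃ y, |y * y - x| < e
  odd : ∀ p : K[X], p.Monic → Odd p.natDegree → ∀ e : K, 0 < e → ∃ y, |p.eval y| < e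

theorem eval_eq_of_monic {R : Type*} [CommRing R] {p : R[X]} (hp : p.Monic) (y : R) :
    p.eval y = y ^ p.natDegree + ∑ i ∈ Finset.range p.natDegree, p.coeff i * y ^ i := by
  rw [eval_eq_sum_range, Finset.sum_range_succ, hp.coeff_natDegree, one_mul, add_comm]

theorem exists_monic_eval {R : Type*} [CommRing R] [Nontrivial R] (d : ℕ) (c : ℕ → R) :
    ∃ q : R[X], q.Monic ∧ q.natDegree = d ∧
      ∀ y, q.eval y = y ^ d + ∑ i ∈ Finset.range d, c i * y ^ i := by
  have hdeg : (∑ i ∈ Finset.range d, C (c i) * X ^ i : R[X]).degree < d := by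
    refine (degree_sum_le _ _).trans_lt ((Finset.sup_lt_iff (WithBot.bot_lt_coe d)).2 fun i hi => ?_)
    exact (degree_C_mul_X_pow_le _ _).trans_lt (Nat.cast_lt.2 (Finset.mem_range.1 hi))
  refine ⟨X ^ d + ∑ i ∈ Finset.range d, C (c i) * X ^ i, monic_X_pow_add hdeg, ?_, fun y => ?_⟩
  · rw [natDegree_eq_of_degree_eq_some]
    rw [degree_add_eq_left_of_degree_lt (by rwa [degree_X_pow]), degree_X_pow]
  · simp [eval_finsetSum]

/-! ### Approximate roots in an ordered extension in which the field is dense -/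

section Order

variable {F : Type*} [Field F] [LinearOrder F] [IsStrictOrderedRing F]

theorem abs_le_of_abs_eval_le_one {d : ℕ} (hd : 0 < d) (b : ℕ → F) {y : F}
    (h : |y ^ d + ∑ i ∈ Finset.range d, b i * y ^ i| ≤ 1) :
    |y| ≤ 1 + ∑ i ∈ Finset.range d, |b i| := by
  by_contra! hlt
  obtain ⟨d, rfl⟩ := Nat.exists_eq_succ_of_ne_zero hd.ne'
  have hs : 0 ≤ ∑ i ∈ Finset.range (d + 1), |b i| := Finset.sum_nonneg fun _ _ => abs_nonneg _
  have h1 : 1 ≤ |y| := by linarith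
  have h2 : |∑ i ∈ Finset.range (d + 1), b i * y ^ i| ≤
      (∑ i ∈ Finset.range (d + 1), |b i|) * |y| ^ d := by
    rw [Finset.sum_mul]
    refine (Finset.abs_sum_le_sum_abs _ _).trans (Finset.sum_le_sum fun i hi => ?_)
    rw [abs_mul, abs_pow]
    exact mul_le_mul_of_nonneg_left
      (pow_le_pow_right₀ h1 (Nat.lt_succ_iff.1 (Finset.mem_range.1 hi))) (abs_nonneg _)
  have h3 : 1 ≤ |y| ^ d := one_le_pow₀ h1
  have h4 : |y| ^ (d + 1) ≤ 1 + (∑ i ∈ Finset.range (d + 1), |b i|) * |y| ^ d := by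
    rw [← abs_pow]
    have h5 := abs_add_le (y ^ (d + 1) + ∑ i ∈ Finset.range (d + 1), b i * y ^ i)
      (-∑ i ∈ Finset.range (d + 1), b i * y ^ i)
    rw [add_neg_cancel_right, abs_neg] at h5
    linarith
  have h6 : (1 + ∑ i ∈ Finset.range (d + 1), |b i|) * |y| ^ d < |y| * |y| ^ d :=
    mul_lt_mul_of_pos_right hlt (by linarith)
  rw [pow_succ'] at h4
  linarith

variable {K : Type*} [Field K] [LinearOrder K] [IsStrictOrderedRing K] [Algebra K F]

theorem abs_algebraMap (h : StrictMono (algebraMap K F)) (x : K) :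
    |algebraMap K F x| = algebraMap K F |x| := by
  rcases le_total 0 x with hx | hx
  · rw [abs_of_nonneg hx, abs_of_nonneg]
    simpa using h.monotone hx
  · rw [abs_of_nonpos hx, abs_of_nonpos, map_neg]
    simpa using h.monotone hx

theorem HasApproximateRoots.exists_odd (hK : HasApproximateRoots K)
    (hmono : StrictMono (algebraMap K F))
    (hdense : ∀ a b : F, a < b → ∃ c : K, a < algebraMap K F c ∧ algebraMap K F c < b)
    {p : F[X]} (hp : p.Monic) (hodd : Odd p.natDegree) {e : F} (he : 0 < e) :
    ∃ y, |p.eval y| < e := by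
  set d := p.natDegree with hd
  -- B bounds every point where a monic polynomial, with coefficients within 1 of those of `p`, has
  -- absolute value at most 1.
  set B : F := 1 + ∑ i ∈ Finset.range d, (|p.coeff i| + 1) with hB
  have hB0 : 0 ≤ B := add_nonneg zero_le_one
    (Finset.sum_nonneg fun _ _ => add_nonneg (abs_nonneg _) zero_le_one)
  have hS : 0 ≤ ∑ i ∈ Finset.range d, B ^ i := Finset.sum_nonneg fun _ _ => pow_nonneg hB0 _
  -- Changing the coefficients by less than δ changes values on [−B, B] by at most e / 2; the added
  -- 1 in the denominator avoids division by 0.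
  obtain ⟨δ, hδ, hδ1, hδ2⟩ : ∃ δ : F, 0 < δ ∧ δ ≤ 1 ∧ δ * ∑ i ∈ Finset.range d, B ^ i ≤ e / 2 := by
    refine ⟨min 1 (e / 2 / (∑ i ∈ Finset.range d, B ^ i + 1)), by positivity, min_le_left _ _, ?_⟩
    refine (mul_le_mul_of_nonneg_right (min_le_right _ _) hS).trans ?_
    rw [div_mul_eq_mul_div, div_le_iff₀ (by positivity)]
    exact mul_le_mul_of_nonneg_left (by linarith) (by positivity)
  have hc : ∀ i, ∃ c : K, |algebraMap K F c - p.coeff i| < δ := fun i => by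
    obtain ⟨c, h1, h2⟩ := hdense (p.coeff i - δ) (p.coeff i + δ) (by linarith)
    exact ⟨c, abs_lt.2 ⟨by linarith, by linarith⟩⟩
  choose c hc using hc
  obtain ⟨q, hq, hqd, hqe⟩ := exists_monic_eval d c
  obtain ⟨e', he', h2⟩ := hdense 0 (min 1 (e / 2)) (by positivity)
  have he0 : 0 < e' := by
    rw [← map_zero (algebraMap K F)] at he'
    exact hmono.lt_iff_lt.1 he'
  obtain ⟨y, hy⟩ := hK.odd q hq (hqd ▸ hodd) e' he0
  set z := algebraMap K F y with hz
  have h3 : |z ^ d + ∑ i ∈ Finset.range d, algebraMap K F (c i) * z ^ i| < min 1 (e / 2) := by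
    have h4 := hmono hy
    rw [← abs_algebraMap hmono, hqe] at h4
    simp only [map_add, map_sum, map_mul, map_pow] at h4
    exact h4.trans h2
  have hzB : |z| ≤ B := by
    refine (abs_le_of_abs_eval_le_one hodd.pos _ (h3.le.trans (min_le_left _ _))).trans ?_
    rw [hB]
    gcongr with i
    have h5 := abs_sub_abs_le_abs_sub (algebraMap K F (c i)) (p.coeff i)
    linarith [hc i]
  refine ⟨z, ?_⟩
  rw [eval_eq_of_monic hp, ← hd]
  have h6 : |∑ i ∈ Finset.range d, (p.coeff i - algebraMap K F (c i)) * z ^ i| ≤ e / 2 := by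
    refine le_trans ?_ hδ2
    rw [Finset.mul_sum]
    refine (Finset.abs_sum_le_sum_abs _ _).trans (Finset.sum_le_sum fun i _ => ?_)
    rw [abs_mul, abs_pow, abs_sub_comm]
    exact mul_le_mul (hc i).le (pow_le_pow_left₀ (abs_nonneg _) hzB _)
      (pow_nonneg (abs_nonneg _) _) hδ.le
  have h7 : z ^ d + ∑ i ∈ Finset.range d, p.coeff i * z ^ i =
      (z ^ d + ∑ i ∈ Finset.range d, algebraMap K F (c i) * z ^ i) +
        ∑ i ∈ Finset.range d, (p.coeff i - algebraMap K F (c i)) * z ^ i := by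
    simp only [sub_mul, Finset.sum_sub_distrib]
    ring
  rw [h7]
  refine (abs_add_le _ _).trans_lt ?_
  have := h3.trans_le (min_le_right _ _)
  linarith

theorem HasApproximateRoots.exists_sq (hK : HasApproximateRoots K)
    (hmono : StrictMono (algebraMap K F))
    (hdense : ∀ a b : F, a < b → ∃ c : K, a < algebraMap K F c ∧ algebraMap K F c < b)
    {a : F} (ha : 0 ≤ a) {e : F} (he : 0 < e) : ∃ y, |y * y - a| < e := by
  -- Approximating from above makes `x` positive even when `a` is 0; the two errors are each below e
  -- / 2.
  obtain ⟨x, h1, h2⟩ := hdense a (a + e / 2) (by linarith)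
  obtain ⟨e', he', h3⟩ := hdense 0 (e / 2) (by linarith)
  have hpos : ∀ {k : K}, 0 < algebraMap K F k → 0 < k := fun h => by
    rw [← map_zero (algebraMap K F)] at h
    exact hmono.lt_iff_lt.1 h
  obtain ⟨y, hy⟩ := hK.sq x e' (hpos (ha.trans_lt h1)) (hpos he')
  have h4 := hmono hy
  rw [← abs_algebraMap hmono, map_sub, map_mul] at h4
  refine ⟨algebraMap K F y, ?_⟩
  rw [abs_lt] at h4 ⊢
  constructor <;> linarith

end Order

/-- The completion has exact square roots of nonnegative elements of `R` and exact roots of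
odd-degree polynomials over `R`. They are algebraic over `K`, hence in `R`, and this is what being
real closed requires. -/
theorem HasApproximateRoots.denseInRealClosure {K : Type w} [Field K] [LinearOrder K]
    [IsStrictOrderedRing K] (hK : HasApproximateRoots K) : DenseInRealClosure K := by
  let : TopologicalSpace K := Preorder.topology K
  have : OrderTopology K := ⟨rfl⟩
  let : UniformSpace K := IsTopologicalAddGroup.rightUniformSpace K
  have : IsUniformAddGroup K := isUniformAddGroup_of_addCommGroup
  let F := UniformSpace.Completion K
  have hmono : StrictMono (algebraMap K F) := completion_coe_strictMono
  have hdense : ∀ a b : F, a < b → ∃ c : K, a < algebraMap K F c ∧ algebraMap K F c < b :=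
    fun a b h => exists_coe_between h
  let R := algebraicClosure K F
  have hmem : ∀ (q : R[X]) (y : F), q ≠ 0 → aeval y q = 0 → y ∈ R := fun q y hq hy => by
    have h : IsAlgebraic R y := ⟨q, hq, hy⟩
    exact mem_algebraicClosure_iff.2 (IsAlgebraic.restrictScalars K h)
  refine ⟨R, inferInstance, inferInstance, inferInstance, ⟨inferInstance,
    IsRealClosed.of_linearOrderedField ?_ ?_, inferInstance, fun a b h => hmono h⟩,
    fun a b h => hdense a b h⟩
  · intro x hx
    obtain ⟨y, hy⟩ := exists_root_of_approx (p := X ^ 2 - C (x : F))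
      (monic_X_pow_sub_C _ two_ne_zero) fun e he => by
        obtain ⟨y, hy⟩ := hK.exists_sq hmono hdense (a := (x : F)) hx he
        exact ⟨y, by simpa [pow_two] using hy⟩
    have hy' : y ^ 2 = x := by simpa [IsRoot, sub_eq_zero] using hy
    refine ⟨⟨y, hmem (X ^ 2 - C x) y (monic_X_pow_sub_C _ two_ne_zero).ne_zero ?_⟩, ?_⟩
    · simp only [map_sub, map_pow, aeval_X, aeval_C]
      rw [hy']
      exact sub_self _
    · exact Subtype.ext (hy'.symm.trans (pow_two y))
  · intro f hf
    have hf0 : f ≠ 0 := by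
      rintro rfl
      simp at hf
    -- Approximate roots are available for monic polynomials, so the leading coefficient is divided
    -- out first.
    set g : F[X] := (f * C f.leadingCoeff⁻¹).map (algebraMap R F)
    have hg : g.Monic := (monic_mul_leadingCoeff_inv hf0).map _
    have hgd : g.natDegree = f.natDegree := by
      rw [natDegree_map, natDegree_mul_leadingCoeff_inv f hf0]
    obtain ⟨y, hy⟩ := exists_root_of_approx hg fun e he =>
      hK.exists_odd hmono hdense hg (hgd ▸ hf) he
    have hy' : aeval y f = 0 := by
      rw [IsRoot, eval_map_algebraMap, map_mul, aeval_C] at hy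
      refine (mul_eq_zero.1 hy).resolve_right ?_
      simpa using hf0
    refine ⟨⟨y, hmem f y hf0 hy'⟩, Subtype.ext ?_⟩
    have h := aeval_algebraMap_apply F (⟨y, hmem f y hf0 hy'⟩ : R) f
    rw [show algebraMap R F ⟨y, hmem f y hf0 hy'⟩ = y from rfl, hy'] at h
    exact h.symm

/-- By continuity `p` is small on an interval around its root `r`, and that interval contains a
point of `K`. -/
theorem exists_abs_eval_lt {K R : Type*} [Field K] [LinearOrder K] [IsStrictOrderedRing K] [Field R]
    [LinearOrder R] [IsStrictOrderedRing R] [Algebra K R] (hmono : StrictMono (algebraMap K R))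
    (hdense : ∀ a b : R, a < b → ∃ c : K, a < algebraMap K R c ∧ algebraMap K R c < b)
    {p : K[X]} {r : R} (hr : aeval r p = 0) {e : K} (he : 0 < e) : ∃ y, |p.eval y| < e := by
  let : TopologicalSpace R := Preorder.topology R
  have : OrderTopology R := ⟨rfl⟩
  have h1 : {z : R | |aeval z p| < algebraMap K R e} ∈ nhds r := by
    have hc : Continuous fun z : R => |aeval z p| := (Polynomial.continuous_aeval p).abs
    refine (isOpen_lt hc continuous_const).mem_nhds ?_
    rw [Set.mem_ofPred_eq, hr, abs_zero, ← map_zero (algebraMap K R)]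
    exact hmono he
  obtain ⟨l, u, ⟨hl, hu⟩, h2⟩ := mem_nhds_iff_exists_Ioo_subset.1 h1
  obtain ⟨c, hc⟩ := hdense l u (hl.trans hu)
  have h3 : |aeval (algebraMap K R c) p| < algebraMap K R e := h2 hc
  rw [aeval_algebraMap_apply, abs_algebraMap hmono] at h3
  exact ⟨c, by simpa using hmono.lt_iff_lt.1 h3⟩

theorem DenseInRealClosure.hasApproximateRoots {K : Type w} [Field K] [LinearOrder K]
    [IsStrictOrderedRing K] (hK : DenseInRealClosure K) : HasApproximateRoots K := by
  obtain ⟨R, _, _, _, ⟨_, _, _, hmono⟩, hdense⟩ := hK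
  constructor
  · intro x e hx he
    have hx' : 0 ≤ algebraMap K R x := by
      rw [← map_zero (algebraMap K R)]
      exact hmono.monotone hx.le
    obtain ⟨r, hr⟩ := IsRealClosed.nonneg_iff_isSquare.1 hx'
    obtain ⟨y, hy⟩ := exists_abs_eval_lt hmono hdense (p := X * X - C x) (r := r)
      (by simp [hr]) he
    exact ⟨y, by simpa using hy⟩
  · intro p hp hodd e he
    obtain ⟨r, hr⟩ := IsRealClosed.exists_isRoot_of_odd_natDegree (f := p.map (algebraMap K R))
      (by rwa [natDegree_map])
    exact exists_abs_eval_lt hmono hdense (r := r) (by rwa [IsRoot, eval_map_algebraMap] at hr) he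

end Approximate

/-! ### The axioms of ordered fields -/

section Axioms

variable {n : ℕ}

/-- The term `0`. -/
def orZero : Lor.Term (Empty ⊕ Fin n) := Constants.term (L := Lor) OrFunc.zero

/-- The term `1`. -/
def orOne : Lor.Term (Empty ⊕ Fin n) := Constants.term (L := Lor) OrFunc.one

/-- The term `-t`. -/
def orNeg (t : Lor.Term (Empty ⊕ Fin n)) : Lor.Term (Empty ⊕ Fin n) :=
  Functions.apply₁ (L := Lor) OrFunc.neg t

/-- The term `s + t`. -/
def orAdd (s t : Lor.Term (Empty ⊕ Fin n)) : Lor.Term (Empty ⊕ Fin n) :=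
  Functions.apply₂ (L := Lor) OrFunc.add s t

/-- The term `s * t`. -/
def orMul (s t : Lor.Term (Empty ⊕ Fin n)) : Lor.Term (Empty ⊕ Fin n) :=
  Functions.apply₂ (L := Lor) OrFunc.mul s t

/-- The formula `s < t`. -/
def orLt (s t : Lor.Term (Empty ⊕ Fin n)) : Lor.BoundedFormula Empty n :=
  Relations.boundedFormula₂ (L := Lor) LtRel.lt s t

/-- The variable with the given index. -/
def orVar (n i : ℕ) : Lor.Term (Empty ⊕ Fin (n + 1)) := &(Fin.ofNat (n + 1) i)

/-- The axioms of ordered fields. -/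
def orderedFieldAxioms : List Lor.Sentence :=
  [∀' ∀' ∀' (orAdd (orAdd (&0) (&1)) (&2) =' orAdd (&0) (orAdd (&1) (&2))),
    ∀' (orAdd orZero (&0) =' &0),
    ∀' (orAdd (orNeg (&0)) (&0) =' orZero),
    ∀' ∀' ∀' (orMul (orMul (&0) (&1)) (&2) =' orMul (&0) (orMul (&1) (&2))),
    ∀' ∀' (orMul (&0) (&1) =' orMul (&1) (&0)),
    ∀' (orMul orOne (&0) =' &0),
    ∀' (∼(&0 =' orZero) ⟹ ∃' (orMul (&0) (&1) =' orOne)),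
    ∀' ∀' ∀' (orMul (&0) (orAdd (&1) (&2)) =' orAdd (orMul (&0) (&1)) (orMul (&0) (&2))),
    ∼(orZero =' orOne),
    ∀' ∼(orLt (&0) (&0)),
    ∀' ∀' ∀' (orLt (&0) (&1) ⟹ (orLt (&1) (&2) ⟹ orLt (&0) (&2))),
    ∀' ∀' (orLt (&0) (&1) ⊔ ((&0 =' &1) ⊔ orLt (&1) (&0))),
    ∀' ∀' ∀' (orLt (&0) (&1) ⟹ orLt (orAdd (&2) (&0)) (orAdd (&2) (&1))),
    ∀' ∀' (orLt orZero (&0) ⟹ (orLt orZero (&1) ⟹ orLt orZero (orMul (&0) (&1))))]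

/-- Positive elements have approximate square roots. -/
def sqAxiom : Lor.Sentence :=
  ∀' ∀' (orLt orZero (&0) ⟹ (orLt orZero (&1) ⟹
    ∃' (orLt (orNeg (&1)) (orAdd (orMul (&2) (&2)) (orNeg (&0))) ⊓
      orLt (orAdd (orMul (&2) (&2)) (orNeg (&0))) (&1))))

/-- The value at the variable with index `d + 1` of the monic polynomial of degree `j` whose other
coefficients are the variables with indices `0, …, j - 1`. -/
def hornerTerm (d : ℕ) : ℕ → Lor.Term (Empty ⊕ Fin (d + 2))
  | 0 => orOne
  | j + 1 => orAdd (orMul (hornerTerm d j) (orVar (d + 1) (d + 1))) (orVar (d + 1) j)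

/-- Monic polynomials of degree `d` have approximate roots. -/
def rootAxiom (d : ℕ) : Lor.Sentence :=
  (orLt orZero (orVar d d) ⟹ ∃' (orLt (orNeg (orVar (d + 1) d)) (hornerTerm d d) ⊓
    orLt (hornerTerm d d) (orVar (d + 1) d))).alls

/-- The theory of ordered fields with approximate roots. -/
def approximateRootTheory : Lor.Theory :=
  {σ | σ ∈ orderedFieldAxioms ∨ σ = sqAxiom ∨ ∃ k : ℕ, σ = rootAxiom (2 * k + 1)}

/-! ### Interpreting the symbols and recovering the ordered field -/

section Realize

variable (K : Type w) [Lor.Structure K]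

/-- The interpretation of `0`. -/
def strZero : K := Structure.funMap (L := Lor) OrFunc.zero ![]

/-- The interpretation of `1`. -/
def strOne : K := Structure.funMap (L := Lor) OrFunc.one ![]

variable {K}

/-- The interpretation of `-`. -/
def strNeg (x : K) : K := Structure.funMap (L := Lor) OrFunc.neg ![x]

/-- The interpretation of `+`. -/
def strAdd (x y : K) : K := Structure.funMap (L := Lor) OrFunc.add ![x, y]

/-- The interpretation of `*`. -/
def strMul (x y : K) : K := Structure.funMap (L := Lor) OrFunc.mul ![x, y]

/-- The interpretation of `<`. -/
def strLt (x y : K) : Prop := Structure.RelMap (L := Lor) LtRel.lt ![x, y]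

variable (e : Empty ⊕ Fin n → K) (s t : Lor.Term (Empty ⊕ Fin n))

theorem realize_orZero : (orZero (n := n)).realize e = strZero K :=
  congrArg (Structure.funMap (L := Lor) OrFunc.zero) (Subsingleton.elim _ _)

theorem realize_orOne : (orOne (n := n)).realize e = strOne K :=
  congrArg (Structure.funMap (L := Lor) OrFunc.one) (Subsingleton.elim _ _)

theorem realize_orNeg : (orNeg t).realize e = strNeg (t.realize e) :=
  Term.realize_functions_apply₁

theorem realize_orAdd : (orAdd s t).realize e = strAdd (s.realize e) (t.realize e) :=
  Term.realize_functions_apply₂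

theorem realize_orMul : (orMul s t).realize e = strMul (s.realize e) (t.realize e) :=
  Term.realize_functions_apply₂

theorem realize_orLt (e : Empty → K) (x : Fin n → K) : (orLt s t).Realize e x ↔
    strLt (s.realize (Sum.elim e x)) (t.realize (Sum.elim e x)) :=
  BoundedFormula.realize_rel₂

variable (K) in
theorem realize_orderedFieldAxioms : (∀ σ ∈ orderedFieldAxioms, K ⊨ σ) ↔
    (∀ a b c : K, strAdd (strAdd a b) c = strAdd a (strAdd b c)) ∧
    (∀ a : K, strAdd (strZero K) a = a) ∧
    (∀ a : K, strAdd (strNeg a) a = strZero K) ∧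
    (∀ a b c : K, strMul (strMul a b) c = strMul a (strMul b c)) ∧
    (∀ a b : K, strMul a b = strMul b a) ∧
    (∀ a : K, strMul (strOne K) a = a) ∧
    (∀ a : K, a ≠ strZero K → ∃ b, strMul a b = strOne K) ∧
    (∀ a b c : K, strMul a (strAdd b c) = strAdd (strMul a b) (strMul a c)) ∧
    strZero K ≠ strOne K ∧
    (∀ a : K, ¬ strLt a a) ∧
    (∀ a b c : K, strLt a b → strLt b c → strLt a c) ∧
    (∀ a b : K, strLt a b ∨ a = b ∨ strLt b a) ∧
    (∀ a b c : K, strLt a b → strLt (strAdd c a) (strAdd c b)) ∧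
    (∀ a b : K, strLt (strZero K) a → strLt (strZero K) b → strLt (strZero K) (strMul a b)) := by
  simp [orderedFieldAxioms, Sentence.Realize, Formula.Realize, realize_orLt, realize_orZero,
    realize_orOne, realize_orNeg, realize_orAdd, realize_orMul, Fin.snoc]

theorem exists_isOrderedFieldStructure (h : ∀ σ ∈ orderedFieldAxioms, K ⊨ σ) :
    ∃ (_ : Field K) (_ : LinearOrder K), IsOrderedFieldStructure K := by
  classical
  obtain ⟨add_assoc', zero_add', neg_add', mul_assoc', mul_comm', one_mul', inv', distrib', h01,
    irrefl', trans', total', add_lt', mul_pos'⟩ := (realize_orderedFieldAxioms K).1 h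
  choose! i hi using inv'
  let : Add K := ⟨strAdd⟩
  let : Mul K := ⟨strMul⟩
  let : Neg K := ⟨strNeg⟩
  let : Zero K := ⟨strZero K⟩
  let : One K := ⟨strOne K⟩
  let : Inv K := ⟨fun a => if a = 0 then 0 else i a⟩
  let F : Field K := Field.ofMinimalAxioms K add_assoc' zero_add' neg_add' mul_assoc' mul_comm'
    one_mul' (fun a ha => by
      change strMul a (if a = 0 then 0 else i a) = strOne K
      rw [if_neg ha]
      exact hi a ha) (if_pos rfl) distrib' ⟨_, _, h01⟩
  have hsto : IsStrictTotalOrder K strLt :=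
    { irrefl := irrefl'
      trans := trans'
      trichotomous := fun a b h1 h2 => (total' a b).elim (fun h => absurd h h1) fun h =>
        h.elim id fun h => absurd h h2 }
  let O : LinearOrder K := linearOrderOfSTO strLt
  refine ⟨F, O, ?_, fun x => congrArg _ (Subsingleton.elim _ _),
    fun x => congrArg _ (Subsingleton.elim _ _), fun x => ?_, fun x => ?_, fun x => ?_,
    fun x => ?_⟩
  · have hadd : IsOrderedAddMonoid K :=
      { add_le_add_left := fun a b hab c => by
          rw [add_comm a c, add_comm b c]
          rcases eq_or_lt_of_le hab with rfl | hab
          · exact le_rfl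
          · exact le_of_lt (add_lt' a b c hab) }
    have hpos : ∀ a b : K, 0 < a → 0 < b → 0 < a * b := mul_pos'
    -- This is not among the axioms: if 1 < 0, then 1 = (−1)(−1) would be positive.
    have hle : (0 : K) ≤ 1 := by
      rcases lt_trichotomy (0 : K) 1 with h | h | h
      · exact h.le
      · exact absurd h h01
      · have := hpos (-1) (-1) (neg_pos.2 h) (neg_pos.2 h)
        rw [neg_mul_neg, one_mul] at this
        exact absurd this h.asymm
    have : ZeroLEOneClass K := ⟨hle⟩
    exact IsStrictOrderedRing.of_mul_pos hpos
  · exact congrArg (Structure.funMap (L := Lor) OrFunc.neg)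
      (funext fun j => by fin_cases j; rfl)
  · exact congrArg (Structure.funMap (L := Lor) OrFunc.add)
      (funext fun j => by fin_cases j <;> rfl)
  · exact congrArg (Structure.funMap (L := Lor) OrFunc.mul)
      (funext fun j => by fin_cases j <;> rfl)
  · exact iff_of_eq (congrArg (Structure.RelMap (L := Lor) LtRel.lt)
      (funext fun j => by fin_cases j <;> rfl))

variable [Field K] [LinearOrder K]

namespace IsOrderedFieldStructure

theorem strZero_eq (hK : IsOrderedFieldStructure K) : strZero K = 0 := hK.zero _

theorem strOne_eq (hK : IsOrderedFieldStructure K) : strOne K = 1 := hK.one _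

theorem strNeg_eq (hK : IsOrderedFieldStructure K) (x : K) : strNeg x = -x := hK.neg _

theorem strAdd_eq (hK : IsOrderedFieldStructure K) (x y : K) : strAdd x y = x + y := hK.add _

theorem strMul_eq (hK : IsOrderedFieldStructure K) (x y : K) : strMul x y = x * y := hK.mul _

theorem strLt_iff (hK : IsOrderedFieldStructure K) (x y : K) : strLt x y ↔ x < y := hK.lt _

theorem realize_axioms (hK : IsOrderedFieldStructure K) : ∀ σ ∈ orderedFieldAxioms, K ⊨ σ := by
  have := hK.isStrictOrderedRing
  rw [realize_orderedFieldAxioms K]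
  simp only [hK.strZero_eq, hK.strOne_eq, hK.strNeg_eq, hK.strAdd_eq, hK.strMul_eq, hK.strLt_iff]
  exact ⟨add_assoc, zero_add, neg_add_cancel, mul_assoc, mul_comm, one_mul,
    fun a ha => ⟨a⁻¹, mul_inv_cancel₀ ha⟩, mul_add, zero_ne_one, lt_irrefl,
    fun _ _ _ => lt_trans, lt_trichotomy, fun a b c h => by linarith, fun _ _ => mul_pos⟩

theorem realize_sqAxiom (hK : IsOrderedFieldStructure K) :
    K ⊨ sqAxiom ↔ ∀ x e : K, 0 < x → 0 < e → ∃ y, |y * y - x| < e := by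
  have := hK.isStrictOrderedRing
  simp [sqAxiom, Sentence.Realize, Formula.Realize, realize_orLt, realize_orZero, realize_orNeg,
    realize_orAdd, realize_orMul, Fin.snoc, hK.strZero_eq, hK.strNeg_eq, hK.strAdd_eq,
    hK.strMul_eq, hK.strLt_iff, abs_lt, sub_eq_add_neg]

/-- Horner's scheme consumes coefficients from the top, so the variable with index k is the
coefficient of degree j − 1 − k. -/
theorem realize_hornerTerm (hK : IsOrderedFieldStructure K) (d j : ℕ)
    (e : Empty ⊕ Fin (d + 2) → K) : (hornerTerm d j).realize e =
      e (.inr (Fin.ofNat _ (d + 1))) ^ j + ∑ i ∈ Finset.range j,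
        e (.inr (Fin.ofNat _ (j - 1 - i))) * e (.inr (Fin.ofNat _ (d + 1))) ^ i := by
  induction j with
  | zero => simp [hornerTerm, realize_orOne, hK.strOne_eq]
  | succ j ih =>
    rw [hornerTerm, realize_orAdd, realize_orMul, hK.strAdd_eq, hK.strMul_eq, ih,
      Finset.sum_range_succ', add_mul, Finset.sum_mul, pow_succ]
    simp only [orVar, Term.realize_var, Function.comp_apply, pow_zero, mul_one, pow_succ, mul_assoc,
      Nat.add_sub_cancel, Nat.sub_zero, add_assoc]
    refine congrArg₂ _ rfl (congrArg₂ _ (Finset.sum_congr rfl fun i _ => ?_) rfl)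
    rw [show j - (i + 1) = j - 1 - i by omega]

theorem realize_rootAxiom (hK : IsOrderedFieldStructure K) (d : ℕ) :
    K ⊨ rootAxiom d ↔ ∀ p : Polynomial K, p.Monic → p.natDegree = d → ∀ e, 0 < e →
      ∃ y, |p.eval y| < e := by
  have := hK.isStrictOrderedRing
  have hlt : ∀ i, i < d + 1 → ∀ (x : Fin (d + 1) → K) (y : K),
      (Fin.snoc x y : Fin (d + 2) → K) (Fin.ofNat (d + 2) i) = x (Fin.ofNat (d + 1) i) := by
    intro i hi x y
    have h : Fin.ofNat (d + 2) i = (Fin.ofNat (d + 1) i).castSucc := by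
      ext
      simp [Nat.mod_eq_of_lt hi, Nat.mod_eq_of_lt (Nat.lt_succ_of_lt hi)]
    rw [h, Fin.snoc_castSucc]
  have hlast : ∀ (x : Fin (d + 1) → K) (y : K),
      (Fin.snoc x y : Fin (d + 2) → K) (Fin.ofNat (d + 2) (d + 1)) = y := by
    intro x y
    have h : Fin.ofNat (d + 2) (d + 1) = Fin.last (d + 1) := by
      ext
      simp
    rw [h, Fin.snoc_last]
  have key : K ⊨ rootAxiom d ↔ ∀ x : Fin (d + 1) → K, 0 < x (Fin.ofNat (d + 1) d) →
      ∃ y, |y ^ d + ∑ i ∈ Finset.range d, x (Fin.ofNat (d + 1) (d - 1 - i)) * y ^ i| <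
        x (Fin.ofNat (d + 1) d) := by
    rw [Sentence.Realize, Formula.Realize, rootAxiom]
    refine BoundedFormula.realize_alls.trans (forall_congr' fun x => ?_)
    simp only [BoundedFormula.realize_imp, BoundedFormula.realize_ex, BoundedFormula.realize_inf,
      realize_orLt, realize_orZero, realize_orNeg, hK.strZero_eq, hK.strNeg_eq, hK.strLt_iff,
      hK.realize_hornerTerm, orVar, Term.realize_var, Function.comp_apply, Sum.elim_inr, hlast,
      hlt d (Nat.lt_succ_self d), abs_lt]
    refine imp_congr_right fun _ => exists_congr fun y => ?_
    rw [Finset.sum_congr rfl fun i _ => by rw [hlt (d - 1 - i) (by omega)] ]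
  rw [key]
  constructor
  · rintro h p hp rfl e he
    -- The coefficients go into the variables in reverse order, and the tolerance e into the last
    -- one.
    set f : Fin (p.natDegree + 1) → K :=
      fun i => if (i : ℕ) < p.natDegree then p.coeff (p.natDegree - 1 - i) else e with hf
    have h1 : f (Fin.ofNat _ p.natDegree) = e := by simp [hf]
    have h2 : ∀ i ∈ Finset.range p.natDegree,
        f (Fin.ofNat _ (p.natDegree - 1 - i)) = p.coeff i := by
      intro i hi
      have hi := Finset.mem_range.1 hi
      have h3 : (p.natDegree - 1 - i) % (p.natDegree + 1) = p.natDegree - 1 - i :=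
        Nat.mod_eq_of_lt (by omega)
      simp only [hf, Fin.ofNat, h3]
      rw [if_pos (by omega), show p.natDegree - 1 - (p.natDegree - 1 - i) = i by omega]
    obtain ⟨y, hy⟩ := h f (h1.symm ▸ he)
    rw [h1, Finset.sum_congr rfl fun i hi => by rw [h2 i hi] ] at hy
    exact ⟨y, by rwa [eval_eq_of_monic hp]⟩
  · intro h x hx
    obtain ⟨p, hp, hd, hpe⟩ := exists_monic_eval d fun i => x (Fin.ofNat (d + 1) (d - 1 - i))
    obtain ⟨y, hy⟩ := h p hp hd _ hx
    exact ⟨y, by rwa [hpe] at hy⟩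

theorem models_approximateRootTheory_iff (hK : IsOrderedFieldStructure K) :
    K ⊨ approximateRootTheory ↔ HasApproximateRoots K := by
  rw [Theory.model_iff]
  constructor
  · intro h
    refine ⟨hK.realize_sqAxiom.1 (h _ (.inr (.inl rfl))), fun p hp hodd => ?_⟩
    obtain ⟨k, hk⟩ := hodd
    exact (hK.realize_rootAxiom _).1 (h _ (.inr (.inr ⟨k, rfl⟩))) p hp hk
  · rintro h σ (hσ | rfl | ⟨k, rfl⟩)
    · exact hK.realize_axioms σ hσ
    · exact hK.realize_sqAxiom.2 h.sq
    · exact (hK.realize_rootAxiom _).2 fun p hp hd => h.odd p hp (hd ▸ ⟨k, rfl⟩)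

end IsOrderedFieldStructure

end Realize

theorem models_approximateRootTheory_iff (K : Type w) [Lor.Structure K] :
    K ⊨ approximateRootTheory ↔ IsOrderedFieldDenseInRealClosure K := by
  constructor
  · intro h
    obtain ⟨_, _, hK⟩ := exists_isOrderedFieldStructure fun σ hσ =>
      (Theory.model_iff _).1 h σ (.inl hσ)
    have := hK.isStrictOrderedRing
    exact ⟨_, _, hK, (hK.models_approximateRootTheory_iff.1 h).denseInRealClosure⟩
  · rintro ⟨_, _, hK, hd⟩
    have := hK.isStrictOrderedRing
    exact hK.models_approximateRootTheory_iff.2 hd.hasApproximateRoots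

/-! ### Recursiveness of the axioms -/

/-- The code of a binary function symbol applied to two terms. -/
def appCode (f a b : ℕ) : ℕ := Nat.pair 1 (Nat.pair f (Encodable.encode [a, b]))

/-- The code of an inequality. -/
def orLtCode (a b : ℕ) : ℕ := Nat.pair 2 (Nat.pair 0 (Encodable.encode [a, b]))

/-- The code of a negative. -/
def orNegCode (a : ℕ) : ℕ := Nat.pair 1 (Nat.pair 2 (Encodable.encode [a]))

/-- The code of a variable. -/
def orVarCode (n i : ℕ) : ℕ := Nat.pair 0 (i % (n + 1))

/-- The code of `hornerTerm`. -/
def hornerCode (d j : ℕ) : ℕ :=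
  Nat.rec (termCode orNumbering (orOne (n := 0)))
    (fun j c => appCode 3 (appCode 4 c (orVarCode (d + 1) (d + 1))) (orVarCode (d + 1) j)) j

/-- The code of `rootAxiom`. -/
def rootAxiomCode (d : ℕ) : ℕ :=
  allsCode (d + 1) (Nat.pair 3 (Nat.pair
    (orLtCode (termCode orNumbering (orZero (n := 0))) (orVarCode d d))
    (exCode (andCode (orLtCode (orNegCode (orVarCode (d + 1) d)) (hornerCode d d))
      (orLtCode (hornerCode d d) (orVarCode (d + 1) d))))))

theorem termCode_orAdd (s t : Lor.Term (Empty ⊕ Fin n)) :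
    termCode orNumbering (orAdd s t) = appCode 3 (termCode orNumbering s) (termCode orNumbering t) := by
  simp [orAdd, Functions.apply₂, termCode, appCode, List.ofFn_succ, orNumbering, orFn]

theorem termCode_orMul (s t : Lor.Term (Empty ⊕ Fin n)) :
    termCode orNumbering (orMul s t) = appCode 4 (termCode orNumbering s) (termCode orNumbering t) := by
  simp [orMul, Functions.apply₂, termCode, appCode, List.ofFn_succ, orNumbering, orFn]

theorem termCode_orNeg (t : Lor.Term (Empty ⊕ Fin n)) :
    termCode orNumbering (orNeg t) = orNegCode (termCode orNumbering t) := by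
  simp [orNeg, Functions.apply₁, termCode, orNegCode, List.ofFn_succ, orNumbering, orFn]

theorem formulaCode_orLt (s t : Lor.Term (Empty ⊕ Fin n)) :
    formulaCode orNumbering (orLt s t) =
      orLtCode (termCode orNumbering s) (termCode orNumbering t) := by
  simp [orLt, Relations.boundedFormula₂, Relations.boundedFormula, formulaCode, orLtCode,
    List.ofFn_succ, orNumbering]

theorem termCode_orVar (n i : ℕ) : termCode orNumbering (orVar n i) = orVarCode n i := rfl

theorem termCode_hornerTerm (d j : ℕ) :
    termCode orNumbering (hornerTerm d j) = hornerCode d j := by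
  induction j with
  | zero => simp [hornerTerm, hornerCode, orOne, Constants.term, termCode]
  | succ j ih =>
    rw [hornerTerm, termCode_orAdd, termCode_orMul, ih, termCode_orVar, termCode_orVar]
    rfl

theorem formulaCode_rootAxiom (d : ℕ) :
    formulaCode orNumbering (rootAxiom d) = rootAxiomCode d := by
  have h0 : termCode orNumbering (orZero (n := d + 1)) = termCode orNumbering (orZero (n := 0)) := by
    simp [orZero, Constants.term, termCode]
  rw [rootAxiom, formulaCode_alls, formulaCode, formulaCode_ex, formulaCode_inf]
  simp only [formulaCode_orLt, termCode_orNeg, termCode_hornerTerm, termCode_orVar, h0]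
  rfl

theorem primrec_appCode {α : Type*} [Primcodable α] (f : ℕ) {g h : α → ℕ} (hg : Primrec g)
    (hh : Primrec h) : Primrec fun a => appCode f (g a) (h a) :=
  primrec_natPair (Primrec.const 1) (primrec_natPair (Primrec.const f) (Primrec.encode.comp
    (primrec_cons hg (primrec_cons hh (Primrec.const [])))))

theorem primrec_orLtCode {α : Type*} [Primcodable α] {g h : α → ℕ} (hg : Primrec g)
    (hh : Primrec h) : Primrec fun a => orLtCode (g a) (h a) :=
  primrec_natPair (Primrec.const 2) (primrec_natPair (Primrec.const 0) (Primrec.encode.comp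
    (primrec_cons hg (primrec_cons hh (Primrec.const [])))))

theorem primrec_orNegCode {α : Type*} [Primcodable α] {g : α → ℕ} (hg : Primrec g) :
    Primrec fun a => orNegCode (g a) :=
  primrec_natPair (Primrec.const 1) (primrec_natPair (Primrec.const 2) (Primrec.encode.comp
    (primrec_cons hg (Primrec.const []))))

theorem primrec_orVarCode {α : Type*} [Primcodable α] {g h : α → ℕ} (hg : Primrec g)
    (hh : Primrec h) : Primrec fun a => orVarCode (g a) (h a) :=
  primrec_natPair (Primrec.const 0) (Primrec.nat_mod.comp hh (primrec_add_one hg))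

/-- The recursion runs on the degree with the variable index `d` as a parameter; only the diagonal
is needed for the axioms. -/
theorem primrec_hornerCode : Primrec fun d => hornerCode d d := by
  refine Primrec.nat_rec' (f := fun d : ℕ => d) (g := fun _ => _)
    (h := fun d (p : ℕ × ℕ) => appCode 3 (appCode 4 p.2 (orVarCode (d + 1) (d + 1)))
      (orVarCode (d + 1) p.1)) Primrec.id (Primrec.const _) ?_
  have hd := primrec_add_one (Primrec.fst (α := ℕ) (β := ℕ × ℕ))
  have hp := Primrec.snd (α := ℕ) (β := ℕ × ℕ)
  exact primrec_appCode 3 (primrec_appCode 4 (primrec_snd hp) (primrec_orVarCode hd hd))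
    (primrec_orVarCode hd (primrec_fst hp))

theorem primrec_rootAxiomCode : Primrec rootAxiomCode := by
  have hd := Primrec.id (α := ℕ)
  have hd' := primrec_add_one hd
  have hv := primrec_orVarCode hd' hd
  exact primrec_allsCode hd' (primrec_natPair (Primrec.const 3) (primrec_natPair
    (primrec_orLtCode (Primrec.const _) (primrec_orVarCode hd hd))
    (primrec_exCode (primrec_andCode (primrec_orLtCode (primrec_orNegCode hv) primrec_hornerCode)
      (primrec_orLtCode primrec_hornerCode hv)))))

/-- Finitely many axioms are added to one family whose codes are a primitive recursive function of
the degree. -/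
theorem semiDec_approximateRootTheory :
    SemiDec fun c => ∃ σ ∈ approximateRootTheory, formulaCode orNumbering σ = c := by
  have hlist : ∀ l : List Lor.Sentence, SemiDec fun c => ∃ σ ∈ l, formulaCode orNumbering σ = c := by
    intro l
    induction l with
    | nil =>
      exact ⟨fun _ => false, Computable.const false, fun c => by simp⟩
    | cons τ l ih =>
      refine (SemiDec.or (semiDec_of_primrecPred (Primrec.eq.comp
        (Primrec.const (formulaCode orNumbering τ)) Primrec.id)) ih).of_iff fun c => ?_
      simp
  have hroot : Primrec fun k : ℕ => rootAxiomCode (2 * k + 1) :=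
    primrec_rootAxiomCode.comp (primrec_add_one (Primrec.nat_mul.comp (Primrec.const 2) Primrec.id))
  refine (SemiDec.or (hlist (sqAxiom :: orderedFieldAxioms))
    (semiDec_range hroot.to_comp)).of_iff fun c => ?_
  constructor
  · rintro ⟨σ, hσ | rfl | ⟨k, rfl⟩, rfl⟩
    · exact .inl ⟨σ, List.mem_cons_of_mem _ hσ, rfl⟩
    · exact .inl ⟨_, List.mem_cons_self, rfl⟩
    · exact .inr ⟨k, (formulaCode_rootAxiom _).symm⟩
  · rintro (⟨σ, hσ, rfl⟩ | ⟨k, rfl⟩)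
    · rcases List.mem_cons.1 hσ with rfl | hσ
      · exact ⟨_, .inr (.inl rfl), rfl⟩
      · exact ⟨σ, .inl hσ, rfl⟩
    · exact ⟨_, .inr (.inr ⟨k, rfl⟩), formulaCode_rootAxiom _⟩

theorem exists_isRecursive_denseInRealClosure :
    ∃ S : Lor.Theory, IsRecursive orNumbering S ∧
      ∀ (K : Type w) [Lor.Structure K], K ⊨ S ↔ IsOrderedFieldDenseInRealClosure K := by
  obtain ⟨S, hS, h⟩ := exists_isRecursive.{0, 0, w} orNumbering semiDec_approximateRootTheory
  exact ⟨S, hS, fun K _ => (h K).trans (models_approximateRootTheory_iff K)⟩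

end Axioms

end DenseRC

theorem mainTheorem8 :
    -- ordered fields dense in their real closure are recursively axiomatisable
    (∃ S : DenseRC.Lor.Theory, DenseRC.IsRecursive DenseRC.orNumbering S ∧
      ∀ (K : Type w) [DenseRC.Lor.Structure K],
        K ⊨ S ↔ DenseRC.IsOrderedFieldDenseInRealClosure K) ∧
    -- the general construction
    (∀ (L : FirstOrder.Language.{u, v}) (ι : DenseRC.Log →ᴸ L), ι.Injective →
      ∀ T S : L.Theory, T.IsComplete → DenseRC.HasQE T →
        DenseRC.Extends T (ι.onTheory DenseRC.Tdoag) → DenseRC.Extends T S →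
        DenseRC.Extends S (ι.onTheory DenseRC.Toag) →
        (∃ S' : L.Theory, S ⊆ S' ∧ DenseRC.AxiomatisesDensity.{u, v, w} ι T S S') ∧
        -- the recursive version
        (∀ ν : DenseRC.Numbering L, DenseRC.IsRecursive ν T → DenseRC.IsRecursive ν S →
          ∃ S' : L.Theory, S ⊆ S' ∧ DenseRC.IsRecursive ν S' ∧
            DenseRC.AxiomatisesDensity.{u, v, w} ι T S S')) := by
  exact ⟨DenseRC.exists_isRecursive_denseInRealClosure, fun L ι _ T S _ hQE _ _ _ =>
    ⟨DenseRC.exists_axiomatisesDensity ι S hQE,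
      fun ν hT hS => DenseRC.exists_isRecursive_axiomatisesDensity ν ι hQE hT hS⟩⟩
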